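/- Conventions. A binary code $C$ of length $n$ is a subspace of $\mathbb F_2^n$, $C^\perp$ is its dual, and $\mathrm{wt}$ is the Hamming weight. For a code $E$ of length $n$ let $D_w(E)$ have point set $\{1,\dots,n\}$ and as blocks the supports of the codewords of $E$ of weight $w$. A collection of $k$-subsets is a $t$-design if $t\le k$ and any $t$ points lie in the same number of blocks (the empty collection is allowed). Let $\delta(E)$ be the largest $t$ such that $D_w(E)$ is a $t$-design for all $0<w<n$ with $D_w(E)\neq\emptyset$, and $s(E)$ the largest $t$ such that $D_w(E)$ is a $t$-design for some $0<w<n$ with $D_w(E)\ne\emptyset$. Say that $C$ is applicable with $(d^\perp,t)=(4,1)$ if $\mathbf 1_n\in C$, $C^\perp$ has minimum distance $4$, and exactly $4-1=3$ numbers $u$ with $0<u\le n-1$ are weights of codewords of $C$. Criteria. Say that $(n,d)$ satisfies the integrality criterion if for some integer $k$ with $2\le k\le n-1$ the number $n(2^{k-1}-n)/(n-2d)^2$ is a positive integer. Say that $(n,d,w)$ satisfies the design criterion if at least one of the following holds: (i) $n^2-(4d+6)n+4d^2+32=0$, and $w=6$, or $n\equiv0\pmod 4$ and $w=n-6$; (ii)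 $n\equiv 2\pmod 4$, $d$ is even, $n^2-(4d+2)n+4d^2+8=0$, and $w=n-4$; (iii) $n^4-(8d+15)n^3+(12d(2d+5)+145)n^2-2(2d(d(8d+15)+100)+285)n+16(d^4+25d^2+109)=0$, and $w\in\{8,n-8\}$; (iv) $n-2d=6$ and $w=2u+8$ for a positive integer $u=\frac{3d-9\pm\sqrt{3d+1}}4$; (v) $n-2d=8$, $d$ is a perfect square, and $w=d+4\pm\sqrt d$. Table B consists of the following 157 entries, written $(n,d:\ w,\dots)$: (16,4: 6,10); (22,6: 6); (22,8: 18); (38,16: 24); (40,16: 16,24); (48,16: 6,42); (54,22: 50); (72,26: 6,66); (72,33: 48,58); (80,36: 34,46); (86,32: 6); (86,40: 58); (102,44: 98); (118,46: 6); (118,56: 94); (136,64: 60,76); (136,65: 94,108); (166,74: 162); (198,96: 156); (208,100: 94,114); (246,104: 6); (246,112: 242); (272,116: 6,266); (296,120: 8,288); (296,144: 136,160); (328,142: 6,322); (328,161: 234,256); (342,158: 338); (358,156: 6); (358,176: 256); (400,196: 186,214); (422,186: 6); (422,208: 328); (454,212: 450); (456,202: 6,450); (520,256: 244,276); (566,254: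 6); (566,280: 438); (582,274: 578); (646,320: 468); (656,324: 310,346); (726,344: 722); (776,385: 564,598); (808,400: 384,424); (886,422: 882); (918,456: 706); (968,446: 6,962); (968,481: 706,744); (976,484: 466,510); (1062,508: 1058); (1072,496: 6,1066); (1126,560: 864); (1160,576: 556,604); (1238,616: 906); (1254,602: 1250); (1296,604: 6,1290); (1360,676: 654,706); (1416,662: 6,1410); (1462,704: 1458); (1478,692: 6); (1478,736: 1084); (1576,784: 760,816); (1606,800: 1228); (1672,786: 6,1666); (1672,833: 1228,1278); (1686,814: 1682); (1808,852: 6,1802); (1808,900: 874,934); (1926,932: 1922); (2056,1024: 996,1060); (2182,1058: 2178); (2248,1066: 6,2242); (2248,1121: 1656,1714); (2320,1156: 1126,1194); (2326,1160: 1714); (2454,1192: 2450); (2486,1182: 6); (2486,1240: 1894); (2600,1296: 1264,1336); (2742,1334: 2738); (2822,1408: 2148); (2896,1444: 1410,1486); (2998,1496: 2214); (3046,1484: 3042); (3208,1600: 1564,1644); (3272,1633: 2418,2488); (3366,1612: 6); (3366,1642: 3362); (3366,1680: 2488); (3536,1764: 1726,1810); (3656,1754: 6,3650); (3656,1825: 2704,2778);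 (3702,1808: 3698); (3856,1852: 6,3850); (3880,1936: 1896,1984); (3958,1976: 3006); (4054,1982: 4050); (4166,2080: 3084); (4240,2116: 2074,2166); (4422,2164: 4418); (4598,2216: 6); (4598,2296: 3406); (4616,2304: 2260,2356); (4806,2354: 4802); (4822,2408: 3658); (4936,2465: 3658,3744); (5008,2500: 2454,2554); (5168,2496: 6,5162); (5206,2552: 5202); (5416,2704: 2656,2760); (5526,2760: 4098); (5622,2758: 5618); (5648,2732: 6,5642); (5840,2916: 2866,2974); (5896,2854: 6,5890); (5896,2945: 4374,4468); (6022,2916: 6); (6022,3008: 4468); (6054,2972: 6050); (6278,3042: 6); (6278,3136: 4756); (6280,3136: 3084,3196); (6408,3201: 4756,4854); (6502,3194: 6498); (6672,3236: 6,6666); (6736,3364: 3310,3426); (6806,3302: 6); (6806,3400: 5154); (6966,3424: 6962); (7078,3536: 5256); (7208,3600: 3544,3664); (7216,3504: 6,7210); (7446,3662: 7442); (7496,3642: 6,7490); (7496,3745: 5568,5674); (7638,3712: 6); (7696,3844: 3786,3910); (7942,3908: 7938); (8072,4033: 5998,6108); (8200,4096: 4036,4164); (8454,4162: 8450); (8518,4256: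 6444); (8720,4356: 4294,4426); (8822,4296: 6); (8822,4408: 6558); (8976,4372: 6,8970); (8982,4424: 8978); (9256,4624: 4560,4696); (9288,4526: 6,9282); (9288,4641: 6906,7024); (9446,4720: 7024); (9526,4694: 9522); (9766,4762: 6); (9766,4880: 7384); (9808,4900: 4834,4974); (9928,4842: 6,9922); (9928,4961: 7384,7506). Statement. (1) The triples $(n,d,w)$ such that $w$ is listed in Table B for $(n,d)$ are exactly the triples of natural numbers with $8<n\le 10000$, $0<d<n/2$, for which $(n,d)$ satisfies the integrality criterion and $(n,d,w)$ satisfies the design criterion. (2) Let $(n,d)$ be in Table B and let $C$ be any code of length $n$ and minimum distance $d$ that is applicable with $(d^\perp,t)=(4,1)$. Then $D_w(C^\perp)$ is a $2$-design for every $w$ listed for $(n,d)$. Moreover, unless $(n,\dim C)=(16,8)$ or $(48,13)$, $D_w(C^\perp)$ is non-empty for every listed $w$, and $\delta(C^\perp)<s(C^\perp)$. -/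

import Mathlib

/-- A binary linear code of length `n`: a subspace of `𝔽₂ⁿ`. -/
abbrev BinaryCode (n : ℕ) : Type := Submodule (ZMod 2) (Fin n → ZMod 2)

namespace BinaryCode

/-- The dual code, with respect to `(x, y) = ∑ i, x i * y i`. -/
def dual {n : ℕ} (C : BinaryCode n) : BinaryCode n where
  carrier := {y | ∀ x ∈ C, ∑ i, x i * y i = 0}
  add_mem' := by
    intro a b ha hb x hx
    simp only [Pi.add_apply, mul_add, Finset.sum_add_distrib]
    rw [ha x hx, hb x hx, add_zero]
  zero_mem' := by
    intro x _
    simp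
  smul_mem' := by
    intro c y hy x hx
    simp only [Pi.smul_apply, smul_eq_mul, mul_left_comm _ c, ← Finset.mul_sum]
    rw [hy x hx, mul_zero]

/-- The support of a vector. -/
def supp {n : ℕ} (c : Fin n → ZMod 2) : Finset (Fin n) := Finset.univ.filter (fun i => c i ≠ 0)

/-- `d` is the minimum distance of `C`: the least weight of a nonzero codeword
(`hammingNorm` counts the nonzero coordinates). In particular `C` has a nonzero codeword. -/
def HasMinDist {n : ℕ} (C : BinaryCode n) (d : ℕ) : Prop :=
  IsLeast {u : ℕ | ∃ c ∈ C, c ≠ 0 ∧ hammingNorm c = u} d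

/-- The weights `u` of codewords of `C` with `0 < u ≤ n - t`. -/
def lowWeights {n : ℕ} (C : BinaryCode n) (t : ℕ) : Set ℕ :=
  {u : ℕ | 0 < u ∧ u + t ≤ n ∧ ∃ c ∈ C, hammingNorm c = u}

/-- `C` is a binary code of length `n` and minimum distance `d` that contains the all-ones vector,
its dual has minimum distance `d'`, and the condition
`d' - t = #{u | C_u ≠ ∅, 0 < u ≤ n - t}`, `0 < t < d'`, of the Assmus-Mattson theorem holds. -/
structure IsAssmusMattson {n : ℕ} (C : BinaryCode n) (d d' t : ℕ) : Prop where
  one_mem : (fun _ => 1) ∈ C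
  minDist : C.HasMinDist d
  dual_minDist : C.dual.HasMinDist d'
  t_pos : 0 < t
  t_lt : t < d'
  card_weights : (C.lowWeights t).ncard = d' - t

open Classical in
/-- The block set of the support design of `C` for weight `w`: the supports of all codewords of
weight `w`. The points are the coordinate indices. It is empty if `C` has no codeword of
weight `w`. -/
noncomputable def supportBlocks {n : ℕ} (C : BinaryCode n) (w : ℕ) : Finset (Finset (Fin n)) :=
  Finset.univ.filter (fun b => ∃ c ∈ C, hammingNorm c = w ∧ supp c = b)

/-- A set `B` of `k`-element subsets of an `n`-element set is (the block set of) a `t`-design: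
`t ≤ k`, and any `t` points lie in precisely `l` blocks, for some constant `l`.
The empty block set is allowed (with `l = 0`); where this matters,
non-emptiness is required separately. -/
def IsDesign {n : ℕ} (t k : ℕ) (B : Finset (Finset (Fin n))) : Prop :=
  t ≤ k ∧ (∀ b ∈ B, b.card = k) ∧
    ∃ l : ℕ, ∀ T : Finset (Fin n), T.card = t → (B.filter (fun b => T ⊆ b)).card = l

/-- `w` is a weight of `C` with `0 < w < n`. For `w = n` the support design would be the one block
of all points, which is trivially a `t`-design for every `t ≤ n`. -/
def IsProperWeight {n : ℕ} (C : BinaryCode n) (w : ℕ) : Prop :=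
  0 < w ∧ w < n ∧ (C.supportBlocks w).Nonempty

/-- `δ(C)`: the largest `t` such that the support design of `C` is a `t`-design for all weights. -/
noncomputable def delta {n : ℕ} (C : BinaryCode n) : ℕ :=
  sSup {t : ℕ | ∀ w, C.IsProperWeight w → IsDesign t w (C.supportBlocks w)}

/-- `s(C)`: the largest `t` such that the support design of `C` is a `t`-design for some weight. -/
noncomputable def sMax {n : ℕ} (C : BinaryCode n) : ℕ :=
  sSup {t : ℕ | ∃ w, C.IsProperWeight w ∧ IsDesign t w (C.supportBlocks w)}

/-- The integrality criterion for `(n, d)`: for some dimension `k` with `2 ≤ k ≤ n - 1`, the number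
`n (2 ^ (k - 1) - n) / (n - 2 d) ^ 2` is a positive integer. -/
def IntegralityCriterion (n d : ℕ) : Prop :=
  ∃ k : ℕ, 2 ≤ k ∧ k ≤ n - 1 ∧ ∃ a : ℕ, 0 < a ∧
    ((n : ℚ) * (2 ^ (k - 1) - n)) / ((n : ℚ) - 2 * d) ^ 2 = a

/-- The criterion on `(n, d, w)`, for dual distance `4` and `t = 1`, under which the support design
of the dual code for weight `w` is a `2`-design: one of five Diophantine conditions. -/
inductive DesignCriterion (n d w : ℕ) : Prop
  | weight6
      (h : (n : ℤ) ^ 2 - (4 * d + 6) * n + 4 * d ^ 2 + 32 = 0)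
      (hw : w = 6 ∨ (n % 4 = 0 ∧ (w : ℤ) = n - 6))
  | weight4
      (hn : n % 4 = 2) (hd : Even d)
      (h : (n : ℤ) ^ 2 - (4 * d + 2) * n + 4 * d ^ 2 + 8 = 0)
      (hw : (w : ℤ) = n - 4)
  | weight8
      (h : (n : ℤ) ^ 4 - (8 * d + 15) * n ^ 3 + (12 * d * (2 * d + 5) + 145) * n ^ 2
        - 2 * (2 * d * (d * (8 * d + 15) + 100) + 285) * n
        + 16 * (d ^ 4 + 25 * d ^ 2 + 109) = 0)
      (hw : w = 8 ∨ (w : ℤ) = n - 8)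
  | gap6
      (hn : (n : ℤ) - 2 * d = 6) (u : ℕ) (hu : 0 < u)
      (h : (u : ℝ) = (3 * d - 9 + Real.sqrt (3 * d + 1)) / 4 ∨
        (u : ℝ) = (3 * d - 9 - Real.sqrt (3 * d + 1)) / 4)
      (hw : w = 2 * u + 8)
  | gap8
      (hn : (n : ℤ) - 2 * d = 8) (r : ℕ) (hr : d = r ^ 2)
      (hw : (w : ℤ) = d + 4 + r ∨ (w : ℤ) = d + 4 - r)

/-- The table for `(d', t) = (4, 1)`: entries `(n, d, [weights w])`. -/
def parameterTable : List (ℕ × ℕ × List ℕ) :=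
  [(16, 4, [6, 10]), (22, 6, [6]), (22, 8, [18]), (38, 16, [24]), (40, 16, [16, 24]),
   (48, 16, [6, 42]), (54, 22, [50]), (72, 26, [6, 66]), (72, 33, [48, 58]), (80, 36, [34, 46]),
   (86, 32, [6]), (86, 40, [58]), (102, 44, [98]), (118, 46, [6]), (118, 56, [94]),
   (136, 64, [60, 76]), (136, 65, [94, 108]), (166, 74, [162]), (198, 96, [156]),
   (208, 100, [94, 114]), (246, 104, [6]), (246, 112, [242]), (272, 116, [6, 266]),
   (296, 120, [8, 288]), (296, 144, [136, 160]), (328, 142, [6, 322]), (328, 161, [234, 256]),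
   (342, 158, [338]), (358, 156, [6]), (358, 176, [256]), (400, 196, [186, 214]), (422, 186, [6]),
   (422, 208, [328]), (454, 212, [450]), (456, 202, [6, 450]), (520, 256, [244, 276]),
   (566, 254, [6]), (566, 280, [438]), (582, 274, [578]), (646, 320, [468]),
   (656, 324, [310, 346]), (726, 344, [722]), (776, 385, [564, 598]), (808, 400, [384, 424]),
   (886, 422, [882]), (918, 456, [706]), (968, 446, [6, 962]), (968, 481, [706, 744]),
   (976, 484, [466, 510]), (1062, 508, [1058]), (1072, 496, [6, 1066]), (1126, 560, [864]),
   (1160, 576, [556, 604]), (1238, 616, [906]), (1254, 602, [1250]), (1296, 604, [6, 1290]),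
   (1360, 676, [654, 706]), (1416, 662, [6, 1410]), (1462, 704, [1458]), (1478, 692, [6]),
   (1478, 736, [1084]), (1576, 784, [760, 816]), (1606, 800, [1228]), (1672, 786, [6, 1666]),
   (1672, 833, [1228, 1278]), (1686, 814, [1682]), (1808, 852, [6, 1802]),
   (1808, 900, [874, 934]), (1926, 932, [1922]), (2056, 1024, [996, 1060]), (2182, 1058, [2178]),
   (2248, 1066, [6, 2242]), (2248, 1121, [1656, 1714]), (2320, 1156, [1126, 1194]),
   (2326, 1160, [1714]), (2454, 1192, [2450]), (2486, 1182, [6]), (2486, 1240, [1894]),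
   (2600, 1296, [1264, 1336]), (2742, 1334, [2738]), (2822, 1408, [2148]),
   (2896, 1444, [1410, 1486]), (2998, 1496, [2214]), (3046, 1484, [3042]),
   (3208, 1600, [1564, 1644]), (3272, 1633, [2418, 2488]), (3366, 1612, [6]),
   (3366, 1642, [3362]), (3366, 1680, [2488]), (3536, 1764, [1726, 1810]),
   (3656, 1754, [6, 3650]), (3656, 1825, [2704, 2778]), (3702, 1808, [3698]),
   (3856, 1852, [6, 3850]), (3880, 1936, [1896, 1984]), (3958, 1976, [3006]),
   (4054, 1982, [4050]), (4166, 2080, [3084]), (4240, 2116, [2074, 2166]), (4422, 2164, [4418]),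
   (4598, 2216, [6]), (4598, 2296, [3406]), (4616, 2304, [2260, 2356]), (4806, 2354, [4802]),
   (4822, 2408, [3658]), (4936, 2465, [3658, 3744]), (5008, 2500, [2454, 2554]),
   (5168, 2496, [6, 5162]), (5206, 2552, [5202]), (5416, 2704, [2656, 2760]),
   (5526, 2760, [4098]), (5622, 2758, [5618]), (5648, 2732, [6, 5642]),
   (5840, 2916, [2866, 2974]), (5896, 2854, [6, 5890]), (5896, 2945, [4374, 4468]),
   (6022, 2916, [6]), (6022, 3008, [4468]), (6054, 2972, [6050]), (6278, 3042, [6]),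
   (6278, 3136, [4756]), (6280, 3136, [3084, 3196]), (6408, 3201, [4756, 4854]),
   (6502, 3194, [6498]), (6672, 3236, [6, 6666]), (6736, 3364, [3310, 3426]), (6806, 3302, [6]),
   (6806, 3400, [5154]), (6966, 3424, [6962]), (7078, 3536, [5256]), (7208, 3600, [3544, 3664]),
   (7216, 3504, [6, 7210]), (7446, 3662, [7442]), (7496, 3642, [6, 7490]),
   (7496, 3745, [5568, 5674]), (7638, 3712, [6]), (7696, 3844, [3786, 3910]),
   (7942, 3908, [7938]), (8072, 4033, [5998, 6108]), (8200, 4096, [4036, 4164]),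
   (8454, 4162, [8450]), (8518, 4256, [6444]), (8720, 4356, [4294, 4426]), (8822, 4296, [6]),
   (8822, 4408, [6558]), (8976, 4372, [6, 8970]), (8982, 4424, [8978]),
   (9256, 4624, [4560, 4696]), (9288, 4526, [6, 9282]), (9288, 4641, [6906, 7024]),
   (9446, 4720, [7024]), (9526, 4694, [9522]), (9766, 4762, [6]), (9766, 4880, [7384]),
   (9808, 4900, [4834, 4974]), (9928, 4842, [6, 9922]), (9928, 4961, [7384, 7506])]

end BinaryCode

namespace BinaryCode

open Polynomial

/-! The classification of the triples is a finite search. Put `g = n - 2 * d`. Each Diophantine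
condition then has one free parameter: (i) and (ii) become `g ^ 2 + 32 = 6 * n` and `g ^ 2 + 8 = 2 *
n`, (iii) is quadratic in `n` over `g` with discriminant `45 * (g ^ 4 - 20 * g ^ 2 + 244)`, and
(iv), (v) fix `g` and force `3 * d + 1`, respectively `d`, to be a square `r ^ 2`. So `n ≤ 10000`
leaves a few hundred candidates. With `j = k - 1`, integrality says that `n * 2 ^ j ≡ n ^ 2` modulo
`g ^ 2` for some `j ≤ n - 2` with `n < 2 ^ j`. It is refuted modulo a small divisor of `g ^ 2`, and
confirmed by an explicit `k`.

For the designs, adding the all-ones word shows that the weights of `C` are `0, d, N, n - d, n` with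
`n = 2 * N`. Poisson summation (`card_mul_sum_dual`) writes the weight enumerator of the dual words
whose support contains `{i, j}` as a sum over `C`. Since the dual has no words of weight 1 or 2, the
coordinate signs `±1` are pairwise orthogonal over `C`. Consequently the enumerator depends on `{i,
j}` only through `S i j`, the sum of the products of the signs at `i` and `j` over the words of
weight `d`, and it is affine in `S i j`. In weight `2 * m + 2` the factor of `S i j` is, up to a
constant, the `m`-th coefficient of `(1 - X) ^ (d - 2) * (evenBinomial (N - d) - (1 - X) ^ (N -
d))`. This coefficient vanishes for every listed weight, which makes the design a `2`-design for any
such `C` (`isDesign_of_coeff`).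

For non-emptiness and `δ < s`, the moment identities determine the weight distribution of `C`, and
so that of its dual, from `n`, `d` and `k = dim C`. A divisibility relation bounds `k`. For each
remaining `k` outside the two exceptions, either the resulting numbers are impossible for a code, or
the dual has words of every listed weight while the number of its words of weight 4 violates the
divisibility condition for a `2`-design. -/

/-- `w` is listed for `(n, d)` in the table. -/
def tableHas (n d w : ℕ) : Bool :=
  parameterTable.any fun e => e.1 == n && (e.2.1 == d && e.2.2.any fun v => v == w)

/-! ### Congruence obstructions and the finite search for admissible triples -/

/-- Pairs `(q, P)` of a modulus and a period of the powers of two modulo that modulus. -/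
def obstructionModuli : List (ℕ × ℕ) :=
  [(8, 1), (7, 3), (1024, 1), (17, 8), (9, 2), (31, 5), (41, 20), (43, 14), (55, 20), (65, 12),
   (73, 9), (79, 39), (89, 11), (103, 51), (109, 36), (113, 28),
   -- These are `p ^ 2` for `p = 37, 53, 59, 67`, and the second entry is not a period of the powers
   -- of two. It is `((2 * p) ^ 2 + 32) / 6`, the length that arises from `g = 2 * p` in the search
   -- for weight 6, so that `n ≤ P + 7` holds and every possible exponent is tried.
   (1369, 918), (2809, 1878), (3481, 2326), (4489, 2998)]

/-- Some modulus in the list shows that `n * 2 ^ j` is not congruent to `n * n` modulo `g * g` for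
any `j` in question. -/
def obstructed (n g : ℕ) : Bool :=
  obstructionModuli.any fun e =>
    g * g % e.1 == 0 && ((n * 2 ^ (e.2 + 6) % e.1 == n * 2 ^ 6 % e.1 || Nat.ble n (e.2 + 7)) &&
      (Nat.blt 0 e.2 && (List.range (e.2 + 2)).all fun i => n * 2 ^ (i + 4) % e.1 != n * n % e.1))

/-- The pair with length `n` and `n - 2 * d = g` is out of range, or violates the integrality
criterion, or is listed with all weights satisfying `ws`. -/
def settled (n g : ℕ) (ws : ℕ → ℕ → Bool) : Bool :=
  Nat.ble n 8 || (Nat.blt 10000 n || (Nat.ble n g || ((n - g) % 2 != 0 ||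
    (obstructed n g || ws n ((n - g) / 2)))))

/-- In this and the following tests a single parameter, `g` or the square root `r`, determines `n`
and `d`. -/
def settledWeight6 (g : ℕ) : Bool :=
  (g * g + 32) % 6 != 0 || settled ((g * g + 32) / 6) g fun n d =>
    tableHas n d 6 && (n % 4 != 0 || tableHas n d (n - 6))

def settledWeight4 (g : ℕ) : Bool :=
  (g * g + 8) % 2 != 0 || settled ((g * g + 8) / 2) g fun n d =>
    n % 4 != 2 || (d % 2 != 0 || tableHas n d (n - 4))

/-- Integer square root by binary digits. -/
def digitSqrt : ℕ → ℕ → ℕ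
  | 0, _ => 0
  | b + 1, D => bif Nat.ble ((2 * digitSqrt b (D / 4) + 1) * (2 * digitSqrt b (D / 4) + 1)) D then
      2 * digitSqrt b (D / 4) + 1 else 2 * digitSqrt b (D / 4)

def settledWeight8 (g : ℕ) : Bool :=
  let D := 45 * (g ^ 4 + 244 - 20 * (g * g))
  let r := digitSqrt 22 D
  -- Checking that `r` is the integer square root of `D` makes a correctness proof for `digitSqrt`
  -- unnecessary.
  Nat.ble (r * r) D && (Nat.blt D ((r + 1) * (r + 1)) && (r * r != D ||
    (settled ((15 * (g * g) + 570 + r) / 90) g (fun n d => tableHas n d 8 && tableHas n d (n - 8)) &&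
     settled ((15 * (g * g) + 570 - r) / 90) g (fun n d => tableHas n d 8 && tableHas n d (n - 8)))))

def settledGap6 (r : ℕ) : Bool :=
  (r * r + 2) % 3 != 0 || (let d := (r * r - 1) / 3
    settled (2 * d + 6) 6 fun n d =>
      ((3 * d + r - 9) % 4 != 0 || (Nat.ble (3 * d + r) 9 || tableHas n d (2 * ((3 * d + r - 9) / 4) + 8))) &&
      (Nat.ble (3 * d) (9 + r) || ((3 * d - 9 - r) % 4 != 0 || tableHas n d (2 * ((3 * d - 9 - r) / 4) + 8))))

def settledGap8 (r : ℕ) : Bool :=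
  settled (2 * (r * r) + 8) 8 fun n d => tableHas n d (d + 4 + r) && tableHas n d (d + 4 - r)

-- The ranges cover all `n ≤ 10000`: `g ^ 2 ≤ 59968` for weight 6, `g ^ 2 ≤ 19992` for weight 4, `r
-- ^ 2 = 3 * d + 1 ≤ 14992` for gap 6 and `r ^ 2 = d ≤ 4996` for gap 8. For weight 8 see the bound
-- in `tableHas_of_weight8`.
set_option maxRecDepth 20000 in
theorem settledWeight6_all : (List.range 246).all settledWeight6 = true := by decide +kernel
set_option maxRecDepth 20000 in
theorem settledWeight4_all : (List.range 142).all settledWeight4 = true := by decide +kernel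
set_option maxRecDepth 20000 in
theorem settledWeight8_all : (List.range 388).all settledWeight8 = true := by decide +kernel
set_option maxRecDepth 20000 in
theorem settledGap6_all : (List.range 130).all settledGap6 = true := by decide +kernel
set_option maxRecDepth 20000 in
theorem settledGap8_all : (List.range 72).all settledGap8 = true := by decide +kernel

theorem exists_of_tableHas {n d w : ℕ} (h : tableHas n d w = true) :
    ∃ W : List ℕ, (n, d, W) ∈ parameterTable ∧ w ∈ W := by
  simp only [tableHas, List.any_eq_true, Bool.and_eq_true, beq_iff_eq] at h
  obtain ⟨⟨n', d', W⟩, hmem, rfl, rfl, v, hv, rfl⟩ := h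
  exact ⟨W, hmem, hv⟩

/-- The integrality criterion in natural numbers. -/
theorem integralityCriterion_iff {n d g : ℕ} (hn : n = 2 * d + g) (hg : 0 < g) :
    IntegralityCriterion n d ↔
      ∃ j : ℕ, 1 ≤ j ∧ j + 2 ≤ n ∧ n < 2 ^ j ∧ (n * 2 ^ j) % (g * g) = n * n % (g * g) := by
  have hgq : ((n : ℚ) - 2 * d) = g := by rw [hn]; push_cast; ring
  have hg0 : (g : ℚ) ≠ 0 := by exact_mod_cast hg.ne'
  constructor
  · rintro ⟨k, hk2, hkn, a, ha, h⟩
    rw [hgq, div_eq_iff (by positivity)] at h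
    have h1 : n * 2 ^ (k - 1) = n * n + a * (g * g) := by
      have : (n : ℚ) * 2 ^ (k - 1) = n * n + a * (g * g) := by linear_combination h
      exact_mod_cast this
    refine ⟨k - 1, by omega, by omega, ?_, ?_⟩
    · have : n * n < n * 2 ^ (k - 1) := by rw [h1]; have : 0 < a * (g * g) := by positivity
                                           omega
      exact lt_of_mul_lt_mul_left this (Nat.zero_le _)
    · rw [h1, Nat.add_mul_mod_self_right]
  · rintro ⟨j, hj1, hjn, hlt, hmod⟩
    have hle : n * n ≤ n * 2 ^ j := Nat.mul_le_mul_left _ hlt.le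
    obtain ⟨a, ha⟩ := (Nat.modEq_iff_dvd' hle).1 hmod.symm
    refine ⟨j + 1, by omega, by omega, a, ?_, ?_⟩
    · rcases Nat.eq_zero_or_pos a with rfl | h
      · have : n * n < n * 2 ^ j := Nat.mul_lt_mul_of_pos_left hlt (by omega)
        omega
      · exact h
    · rw [hgq, div_eq_iff (by positivity)]
      have h1 : n * 2 ^ j = n * n + g * g * a := by omega
      have h2 : (n : ℚ) * 2 ^ j = n * n + g * g * a := by exact_mod_cast h1
      simp only [Nat.add_sub_cancel]
      linear_combination h2

/-- As `n > 8`, an admissible exponent is at least 4. If `n * 2 ^ i` has period `P` modulo `q` from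
`i = 6` on, every exponent reduces to one of `4, …, P + 5`. If instead `n ≤ P + 7`, then `j ≤ n - 2`
already lies in that range. -/
theorem not_integralityCriterion_of_obstructed {n d g : ℕ} (hn : n = 2 * d + g) (hg : 0 < g)
    (h8 : 8 < n) (h : obstructed n g = true) : ¬ IntegralityCriterion n d := by
  rw [integralityCriterion_iff hn hg]
  rintro ⟨j, hj1, hjn, hlt, hmod⟩
  simp only [obstructed, List.any_eq_true, Bool.and_eq_true, Bool.or_eq_true, beq_iff_eq,
    List.all_eq_true, List.mem_range, bne_iff_ne, Nat.ble_eq, Nat.blt_eq] at h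
  obtain ⟨⟨q, P⟩, -, hq, hper, hP, hall⟩ := h
  simp only at hq hper hP hall
  have hqd : q ∣ g * g := Nat.dvd_of_mod_eq_zero hq
  have hmodq : n * 2 ^ j ≡ n * n [MOD q] := Nat.ModEq.of_dvd hqd hmod
  have hj4 : 4 ≤ j := by
    by_contra hlt4
    have : 2 ^ j ≤ 2 ^ 3 := Nat.pow_le_pow_right (by norm_num) (by omega)
    omega
  have key : ∀ i, 4 ≤ i → i + 2 ≤ n → ¬ n * 2 ^ i ≡ n * n [MOD q] := by
    intro i
    induction i using Nat.strong_induction_on with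
    | _ i ih =>
      intro hi hin hc
      by_cases hsmall : i < P + 6
      · have := hall (i - 4) (by omega)
        rw [Nat.sub_add_cancel hi] at this
        exact this hc
      · rcases hper with hper | hper
        · refine ih (i - P) (by omega) (by omega) (by omega) (Nat.ModEq.trans ?_ hc)
          have e1 : n * 2 ^ (i - P) = n * 2 ^ 6 * 2 ^ (i - P - 6) := by
            rw [mul_assoc, ← pow_add]; congr 2; omega
          have e2 : n * 2 ^ i = n * 2 ^ (P + 6) * 2 ^ (i - P - 6) := by
            rw [mul_assoc, ← pow_add]; congr 2; omega
          rw [e1, e2]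
          exact Nat.ModEq.mul_right _ (Nat.ModEq.symm hper)
        · omega
  exact key j hj4 hjn hmodq

theorem of_settled {n d g : ℕ} {ws : ℕ → ℕ → Bool} (h : settled n g ws = true)
    (hn : n = 2 * d + g) (hg : 0 < g) (h8 : 8 < n) (hN : n ≤ 10000) (hd : 0 < d)
    (hI : IntegralityCriterion n d) : ws n d = true := by
  simp only [settled, Bool.or_eq_true, Nat.ble_eq, Nat.blt_eq, bne_iff_ne] at h
  rcases h with h | h | h | h | h | h
  · omega
  · omega
  · omega
  · omega
  · exact absurd hI (not_integralityCriterion_of_obstructed hn hg h8 h)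
  · rwa [show (n - g) / 2 = d by omega] at h

theorem tableHas_of_weight6 {n d g w : ℕ} (hn : n = 2 * d + g) (hg : 0 < g) (h8 : 8 < n)
    (hN : n ≤ 10000) (hd : 0 < d) (hI : IntegralityCriterion n d)
    (h : (n : ℤ) ^ 2 - (4 * d + 6) * n + 4 * d ^ 2 + 32 = 0)
    (hw : w = 6 ∨ (n % 4 = 0 ∧ (w : ℤ) = n - 6)) : tableHas n d w = true := by
  have h1 : g * g + 32 = 6 * n := by
    have : (n : ℤ) = 2 * d + g := by exact_mod_cast hn
    have h2 : (g * g + 32 : ℤ) = 6 * n := by rw [this] at h ⊢; linear_combination h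
    exact_mod_cast h2
  have hg' : g < 246 := by nlinarith
  have hs := List.all_eq_true.1 settledWeight6_all g (List.mem_range.2 hg')
  simp only [settledWeight6, Bool.or_eq_true, bne_iff_ne] at hs
  rcases hs with hs | hs
  · omega
  · rw [h1, Nat.mul_div_cancel_left _ (by norm_num)] at hs
    have := of_settled hs hn hg h8 hN hd hI
    simp only [Bool.or_eq_true, bne_iff_ne, Bool.and_eq_true] at this
    rcases hw with rfl | ⟨h4, hw⟩
    · exact this.1
    · rw [show w = n - 6 by omega]
      exact this.2.resolve_left (by omega)

theorem tableHas_of_weight4 {n d g w : ℕ} (hn : n = 2 * d + g) (hg : 0 < g) (h8 : 8 < n)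
    (hN : n ≤ 10000) (hd : 0 < d) (hI : IntegralityCriterion n d) (hn4 : n % 4 = 2) (hde : Even d)
    (h : (n : ℤ) ^ 2 - (4 * d + 2) * n + 4 * d ^ 2 + 8 = 0) (hw : (w : ℤ) = n - 4) :
    tableHas n d w = true := by
  have h1 : g * g + 8 = 2 * n := by
    have : (n : ℤ) = 2 * d + g := by exact_mod_cast hn
    have h2 : (g * g + 8 : ℤ) = 2 * n := by rw [this] at h ⊢; linear_combination h
    exact_mod_cast h2
  have hg' : g < 142 := by nlinarith
  have hs := List.all_eq_true.1 settledWeight4_all g (List.mem_range.2 hg')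
  simp only [settledWeight4, Bool.or_eq_true, bne_iff_ne] at hs
  rcases hs with hs | hs
  · omega
  · rw [h1, Nat.mul_div_cancel_left _ (by norm_num)] at hs
    have := of_settled hs hn hg h8 hN hd hI
    simp only [Bool.or_eq_true, bne_iff_ne] at this
    rw [show w = n - 4 by omega]
    exact (this.resolve_left (by omega)).resolve_left (by have := Nat.even_iff.1 hde; omega)

theorem tableHas_of_weight8 {n d g w : ℕ} (hn : n = 2 * d + g) (hg : 0 < g) (h8 : 8 < n)
    (hN : n ≤ 10000) (hd : 0 < d) (hI : IntegralityCriterion n d)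
    (h : (n : ℤ) ^ 4 - (8 * d + 15) * n ^ 3 + (12 * d * (2 * d + 5) + 145) * n ^ 2
        - 2 * (2 * d * (d * (8 * d + 15) + 100) + 285) * n
        + 16 * (d ^ 4 + 25 * d ^ 2 + 109) = 0)
    (hw : w = 8 ∨ (w : ℤ) = n - 8) : tableHas n d w = true := by
  have hnz : (n : ℤ) = 2 * d + g := by exact_mod_cast hn
  have hq : (g : ℤ) ^ 4 + 100 * g ^ 2 + 1744 + 45 * n ^ 2 = (15 * g ^ 2 + 570) * n := by
    rw [hnz] at h ⊢; linear_combination h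
  -- Since `388 ^ 2 > 15 * 10000`, for larger `g` the term `g ^ 4` exceeds `15 * g ^ 2 * n` by more
  -- than the rest can compensate.
  have hg' : g < 388 := by
    by_contra hge
    push Not at hge
    have h1 : (388 : ℤ) ≤ g := by exact_mod_cast hge
    have h2 : (n : ℤ) ≤ 10000 := by exact_mod_cast hN
    have h3 : (150544 : ℤ) ≤ g ^ 2 := by nlinarith
    nlinarith [mul_nonneg (sub_nonneg.2 h3) (sub_nonneg.2 h2)]
  have hs := List.all_eq_true.1 settledWeight8_all g (List.mem_range.2 hg')
  simp only [settledWeight8, Bool.or_eq_true, bne_iff_ne, Bool.and_eq_true, Nat.ble_eq,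
    Nat.blt_eq] at hs
  set D := 45 * (g ^ 4 + 244 - 20 * (g * g)) with hD
  set r := digitSqrt 22 D with hr
  obtain ⟨hs1, hs2, hs3⟩ := hs
  have hDz : (D : ℤ) = 45 * (g ^ 4 + 244 - 20 * (g * g)) := by
    have : 20 * (g * g) ≤ g ^ 4 + 244 := by
      zify; nlinarith [sq_nonneg ((g : ℤ) ^ 2 - 10)]
    rw [hD]; push_cast [Nat.cast_sub this]; ring
  -- Completing the square in `hq`: `x` is the square root of the discriminant, so `n` is one of the
  -- two roots.
  set x := (90 * (n : ℤ) - (15 * g ^ 2 + 570)).natAbs with hx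
  have hxx : (x : ℤ) * x = D := by
    rw [hx, Int.natAbs_mul_self', hDz]; linear_combination 180 * hq
  have hxx' : x * x = D := by exact_mod_cast hxx
  have hxr : x = r := by
    rw [← hxx'] at hs1 hs2
    have a1 := Nat.mul_self_le_mul_self_iff.1 hs1
    have a2 := Nat.mul_self_lt_mul_self_iff.1 hs2
    omega
  have hs4 := hs3.resolve_left (by rw [← hxr]; simpa using hxx')
  have concl : ∀ m, m = n → settled m g (fun n d => tableHas n d 8 && tableHas n d (n - 8)) = true →
      tableHas n d w = true := by
    rintro m rfl hm
    have := of_settled hm hn hg h8 hN hd hI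
    simp only [Bool.and_eq_true] at this
    rcases hw with rfl | hw
    · exact this.1
    · rw [show w = m - 8 by omega]
      exact this.2
  have hgg : (g : ℤ) ^ 2 = ((g * g : ℕ) : ℤ) := by push_cast; ring
  rw [hgg] at hx
  rcases le_total 0 (90 * (n : ℤ) - (15 * (g * g : ℕ) + 570)) with hpos | hneg
  · exact concl _ (by omega) hs4.1
  · exact concl _ (by omega) hs4.2

/-- The radicand in the condition for `n - 2 * d = 6` is a perfect square. -/
theorem exists_sq_of_gap6 {d u : ℕ} (h : (u : ℝ) = (3 * d - 9 + Real.sqrt (3 * d + 1)) / 4 ∨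
        (u : ℝ) = (3 * d - 9 - Real.sqrt (3 * d + 1)) / 4) :
    (4 * (u : ℤ) + 9 - 3 * d) ^ 2 = 3 * d + 1 := by
  have hs : Real.sqrt (3 * d + 1) ^ 2 = 3 * d + 1 := Real.sq_sqrt (by positivity)
  have : (4 * (u : ℝ) + 9 - 3 * d) ^ 2 = 3 * d + 1 := by
    rcases h with h | h <;> rw [h] <;> linear_combination hs
  exact_mod_cast this

theorem gap6_of_sq {d u : ℕ} (h : (4 * (u : ℤ) + 9 - 3 * d) ^ 2 = 3 * d + 1) :
    (u : ℝ) = (3 * d - 9 + Real.sqrt (3 * d + 1)) / 4 ∨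
        (u : ℝ) = (3 * d - 9 - Real.sqrt (3 * d + 1)) / 4 := by
  have h1 : (4 * (u : ℝ) + 9 - 3 * d) ^ 2 = 3 * d + 1 := by exact_mod_cast h
  rw [← h1, Real.sqrt_sq_eq_abs]
  rcases abs_choice (4 * (u : ℝ) + 9 - 3 * d) with h2 | h2 <;> rw [h2]
  · left; ring
  · right; ring

theorem tableHas_of_gap6 {n d u : ℕ} (hn : n = 2 * d + 6) (h8 : 8 < n)
    (hN : n ≤ 10000) (hd : 0 < d) (hI : IntegralityCriterion n d) (hu : 0 < u)
    (h : (4 * (u : ℤ) + 9 - 3 * d) ^ 2 = 3 * d + 1) : tableHas n d (2 * u + 8) = true := by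
  set r := (4 * (u : ℤ) + 9 - 3 * d).natAbs with hr
  have hrr : r * r = 3 * d + 1 := by
    have : (r : ℤ) * r = 3 * d + 1 := by rw [hr, Int.natAbs_mul_self', ← h]; ring
    exact_mod_cast this
  have hr' : r < 130 := by nlinarith
  have hs := List.all_eq_true.1 settledGap6_all r (List.mem_range.2 hr')
  simp only [settledGap6, Bool.or_eq_true, bne_iff_ne] at hs
  rcases hs with hs | hs
  · omega
  · rw [show (r * r - 1) / 3 = d by omega, ← hn] at hs
    have := of_settled hs hn (by norm_num) h8 hN hd hI
    simp only [Bool.and_eq_true, Bool.or_eq_true, bne_iff_ne, Nat.ble_eq] at this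
    rcases le_total 0 (4 * (u : ℤ) + 9 - 3 * d) with hpos | hneg
    · have h1 := (this.1.resolve_left (by omega)).resolve_left (by omega)
      rwa [show (3 * d + r - 9) / 4 = u by omega] at h1
    · have h1 := (this.2.resolve_left (by omega)).resolve_left (by omega)
      rwa [show (3 * d - 9 - r) / 4 = u by omega] at h1

theorem tableHas_of_gap8 {n d r w : ℕ} (hn : n = 2 * d + 8) (h8 : 8 < n)
    (hN : n ≤ 10000) (hd : 0 < d) (hI : IntegralityCriterion n d) (hr : d = r ^ 2)
    (hw : (w : ℤ) = d + 4 + r ∨ (w : ℤ) = d + 4 - r) : tableHas n d w = true := by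
  rw [pow_two] at hr
  have hr' : r < 72 := by nlinarith
  have hs := List.all_eq_true.1 settledGap8_all r (List.mem_range.2 hr')
  simp only [settledGap8, ← hr, ← hn] at hs
  have := of_settled hs hn (by norm_num) h8 hN hd hI
  simp only [Bool.and_eq_true] at this
  rcases hw with hw | hw
  · rw [show w = d + 4 + r by omega]; exact this.1
  · rw [show w = d + 4 - r by omega]; exact this.2

theorem tableHas_of_criteria {n d w : ℕ} (h8 : 8 < n) (hN : n ≤ 10000) (hd : 0 < d)
    (hdn : 2 * d < n) (hI : IntegralityCriterion n d) (hD : DesignCriterion n d w) :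
    tableHas n d w = true := by
  obtain ⟨g, hn⟩ : ∃ g, n = 2 * d + g := ⟨n - 2 * d, by omega⟩
  have hg : 0 < g := by omega
  cases hD with
  | weight6 h hw => exact tableHas_of_weight6 hn hg h8 hN hd hI h hw
  | weight4 h4 hde h hw => exact tableHas_of_weight4 hn hg h8 hN hd hI h4 hde h hw
  | weight8 h hw => exact tableHas_of_weight8 hn hg h8 hN hd hI h hw
  | gap6 hn6 u hu h hw =>
    rw [hw]; exact tableHas_of_gap6 (by omega) h8 hN hd hI hu (exists_sq_of_gap6 h)
  | gap8 hn8 r hr hw => exact tableHas_of_gap8 (by omega) h8 hN hd hI hr hw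

/-! ### Verification of the table entries -/

/-- For each entry of the table, the least dimension that meets the integrality criterion. -/
def tableDimensions : List ℕ :=
  [6, 18, 9, 8, 7, 7, 23, 18, 8, 8, 27, 12, 24, 37, 13, 9, 13, 57, 9, 9, 208, 113, 18, 23, 10,
   27, 15, 159, 96, 11, 10, 398, 10, 63, 37, 11, 280, 16, 139, 11, 11, 345, 14, 11, 45, 11, 208,
   12, 11, 256, 18, 13, 12, 12, 503, 27, 12, 96, 489, 745, 14, 12, 15, 398, 17, 815, 37, 12,
   158, 13, 333, 280, 17, 13, 15, 423, 779, 14, 13, 1335, 18, 13, 13, 159, 13, 18, 2474, 823,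
   13, 13, 1023, 14, 605, 208, 13, 17, 543, 16, 14, 1084, 3213, 16, 14, 1032, 17, 15, 14, 27,
   411, 14, 14, 2759, 96, 14, 745, 19, 1918, 19, 223, 706, 18, 14, 14, 345, 398, 14, 4436, 14,
   3425, 15, 14, 37, 3663, 2276, 16, 6401, 14, 381, 16, 15, 783, 15, 15, 3638, 20, 280, 4425,
   15, 2913, 15, 18, 1521, 2997, 19, 15, 779, 19]

/-- Integer form of the design criterion. -/
def designTest (n d w : ℕ) : Bool :=
  ((n : ℤ) ^ 2 - (4 * d + 6) * n + 4 * d ^ 2 + 32 == 0 &&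
    (w == 6 || (n % 4 == 0 && (w : ℤ) == n - 6))) ||
  ((n % 4 == 2 && (d % 2 == 0 && ((n : ℤ) ^ 2 - (4 * d + 2) * n + 4 * d ^ 2 + 8 == 0 &&
    (w : ℤ) == n - 4))) ||
  (((n : ℤ) ^ 4 - (8 * d + 15) * n ^ 3 + (12 * d * (2 * d + 5) + 145) * n ^ 2
        - 2 * (2 * d * (d * (8 * d + 15) + 100) + 285) * n
        + 16 * (d ^ 4 + 25 * d ^ 2 + 109) == 0 && (w == 8 || (w : ℤ) == n - 8)) ||
  ((n == 2 * d + 6 && (Nat.blt 8 w && (w % 2 == 0 &&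
    (4 * (((w - 8) / 2 : ℕ) : ℤ) + 9 - 3 * d) ^ 2 == 3 * d + 1))) ||
  (n == 2 * d + 8 && ((w : ℤ) - d - 4) ^ 2 == d))))

theorem designCriterion_of_designTest {n d w : ℕ} (h : designTest n d w = true) :
    DesignCriterion n d w := by
  simp only [designTest, Bool.or_eq_true, Bool.and_eq_true, beq_iff_eq, Nat.blt_eq] at h
  rcases h with ⟨h, hw⟩ | ⟨h4, hd, h, hw⟩ | ⟨h, hw⟩ | ⟨hn, hw8, hw2, h⟩ | ⟨hn, h⟩
  · exact .weight6 h hw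
  · exact .weight4 h4 (Nat.even_iff.2 hd) h hw
  · exact .weight8 h hw
  · exact .gap6 (by omega) ((w - 8) / 2) (by omega) (gap6_of_sq h) (by omega)
  · refine .gap8 (by omega) ((w : ℤ) - d - 4).natAbs ?_ (by omega)
    have : (d : ℤ) = ((w : ℤ) - d - 4).natAbs ^ 2 := by rw [Int.natAbs_sq, h]
    exact_mod_cast this

/-- The range conditions and criteria for a table entry, with a dimension as witness. -/
def entryTest (e : (ℕ × ℕ × List ℕ) × ℕ) : Bool :=
  Nat.blt 8 e.1.1 && (Nat.ble e.1.1 10000 && (Nat.blt 2 e.1.2.1 && (Nat.blt (2 * e.1.2.1) e.1.1 &&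
    ((Nat.blt 1 e.2 && (Nat.blt e.2 e.1.1 && (Nat.blt e.1.1 (2 ^ (e.2 - 1)) &&
      (e.1.1 * 2 ^ (e.2 - 1)) % ((e.1.1 - 2 * e.1.2.1) * (e.1.1 - 2 * e.1.2.1)) ==
        e.1.1 * e.1.1 % ((e.1.1 - 2 * e.1.2.1) * (e.1.1 - 2 * e.1.2.1))))) &&
    e.1.2.2.all fun w => designTest e.1.1 e.1.2.1 w))))

theorem entryTest_all : (parameterTable.zip tableDimensions).all entryTest = true := by
  decide +kernel

theorem map_fst_zip_tableDimensions :
    (parameterTable.zip tableDimensions).map Prod.fst = parameterTable :=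
  List.map_fst_zip (by decide +kernel)

theorem criteria_of_mem_parameterTable {n d : ℕ} {W : List ℕ} (h : (n, d, W) ∈ parameterTable) :
    8 < n ∧ n ≤ 10000 ∧ 2 < d ∧ 2 * d < n ∧ IntegralityCriterion n d ∧
      ∀ w ∈ W, DesignCriterion n d w := by
  rw [← map_fst_zip_tableDimensions] at h
  obtain ⟨⟨e, k⟩, he, rfl⟩ := List.mem_map.1 h
  have ht := List.all_eq_true.1 entryTest_all _ he
  simp only [entryTest, Bool.and_eq_true, Nat.blt_eq, Nat.ble_eq, beq_iff_eq,
    List.all_eq_true] at ht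
  obtain ⟨h1, h2, h3, h4, ⟨h5, h6, h7, h8⟩, h9⟩ := ht
  refine ⟨h1, h2, h3, h4, ?_, fun w hw => designCriterion_of_designTest (h9 w hw)⟩
  rw [integralityCriterion_iff (g := n - 2 * d) (by omega) (by omega)]
  exact ⟨k - 1, by omega, by omega, h7, h8⟩

theorem mem_parameterTable_iff (n d w : ℕ) :
    (∃ W : List ℕ, (n, d, W) ∈ parameterTable ∧ w ∈ W) ↔
      (8 < n ∧ n ≤ 10000 ∧ 0 < d ∧ 2 * d < n ∧ IntegralityCriterion n d ∧
        DesignCriterion n d w) := by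
  constructor
  · rintro ⟨W, hW, hw⟩
    obtain ⟨h1, h2, h3, h4, h5, h6⟩ := criteria_of_mem_parameterTable hW
    exact ⟨h1, h2, by omega, h4, h5, h6 w hw⟩
  · rintro ⟨h1, h2, h3, h4, h5, h6⟩
    exact exists_of_tableHas (tableHas_of_criteria h1 h2 h3 h4 h5 h6)

/-! ### Characters, Poisson summation and enumerators of words through given points -/

section

/-- The nontrivial character of `ZMod 2`. -/
def sgn (a : ZMod 2) : ℤ := if a = 0 then 1 else -1

@[simp] theorem sgn_zero : sgn 0 = 1 := rfl

@[simp] theorem sgn_one : sgn 1 = -1 := rfl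

theorem sgn_add (a b : ZMod 2) : sgn (a + b) = sgn a * sgn b := by
  revert a b; decide

theorem sgn_mul_self (a : ZMod 2) : sgn a * sgn a = 1 := by
  revert a; decide

theorem sgn_sum {ι : Type*} (s : Finset ι) (f : ι → ZMod 2) :
    sgn (∑ i ∈ s, f i) = ∏ i ∈ s, sgn (f i) := by
  classical
  induction s using Finset.induction_on with
  | empty => simp
  | insert a s ha ih => rw [Finset.sum_insert ha, Finset.prod_insert ha, sgn_add, ih]

variable {n : ℕ}

open Classical in
/-- The finite set of codewords. -/
noncomputable def words (C : BinaryCode n) : Finset (Fin n → ZMod 2) :=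
  Finset.univ.filter (· ∈ C)

/-- The finite set of codewords of weight `u`. -/
noncomputable def wordsOf (C : BinaryCode n) (u : ℕ) : Finset (Fin n → ZMod 2) :=
  C.words.filter (hammingNorm · = u)

@[simp] theorem mem_words {C : BinaryCode n} {x : Fin n → ZMod 2} : x ∈ C.words ↔ x ∈ C := by
  simp [words]

@[simp] theorem mem_wordsOf {C : BinaryCode n} {u : ℕ} {x : Fin n → ZMod 2} :
    x ∈ C.wordsOf u ↔ x ∈ C ∧ hammingNorm x = u := by
  simp [wordsOf]

theorem card_words (C : BinaryCode n) : C.words.card = 2 ^ Module.finrank (ZMod 2) C := by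
  classical
  have h := Module.card_eq_pow_finrank (K := ZMod 2) (V := C)
  rw [ZMod.card, Fintype.card_subtype] at h
  rw [← h, words]

theorem mem_dual {C : BinaryCode n} {y : Fin n → ZMod 2} :
    y ∈ C.dual ↔ ∀ x ∈ C, ∑ i, x i * y i = 0 := Iff.rfl

theorem sum_words_add {M : Type*} [AddCommMonoid M] {C : BinaryCode n} {z : Fin n → ZMod 2}
    (hz : z ∈ C) (g : (Fin n → ZMod 2) → M) : ∑ x ∈ C.words, g (x + z) = ∑ x ∈ C.words, g x :=
  Finset.sum_equiv (Equiv.addRight z) (by intro x; simp [C.add_mem_iff_left hz]) (by simp)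

/-- Orthogonality of characters. -/
theorem sum_words_sgn_of_not_mem {C : BinaryCode n} {y : Fin n → ZMod 2} (hy : y ∉ C.dual) :
    ∑ x ∈ C.words, sgn (∑ i, x i * y i) = 0 := by
  rw [mem_dual] at hy
  push Not at hy
  obtain ⟨z, hz, hzy⟩ := hy
  have h1 : sgn (∑ i, z i * y i) = -1 := by rw [sgn, if_neg hzy]
  have h := sum_words_add hz fun x => sgn (∑ i, x i * y i)
  simp only [Pi.add_apply, add_mul, Finset.sum_add_distrib, sgn_add, h1] at h
  rw [← Finset.sum_mul] at h
  linarith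

/-- Poisson summation for a binary code and its dual. -/
theorem sum_words_transform {R : Type*} [CommRing R] (C : BinaryCode n)
    (f : (Fin n → ZMod 2) → R) :
    ∑ x ∈ C.words, ∑ y, f y * (sgn (∑ i, x i * y i) : R) =
      C.words.card * ∑ y ∈ C.dual.words, f y := by
  classical
  rw [Finset.sum_comm, words.eq_1 C.dual, Finset.sum_filter, Finset.mul_sum]
  refine Finset.sum_congr rfl fun y _ => ?_
  rw [← Finset.mul_sum]
  split_ifs with hy
  · have : ∀ x ∈ C.words, (sgn (∑ i, x i * y i) : R) = 1 := fun x hx => by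
      rw [mem_dual.1 hy x (mem_words.1 hx)]; simp
    rw [Finset.sum_congr rfl this, Finset.sum_const, nsmul_one, mul_comm]
  · rw [← Int.cast_sum, sum_words_sgn_of_not_mem hy]; simp

/-- The Fourier transform of a product function factors over the coordinates. -/
theorem sum_prod_mul_sgn {R : Type*} [CommRing R] (α β : Fin n → R) (x : Fin n → ZMod 2) :
    ∑ y : Fin n → ZMod 2, (∏ i, if y i = 0 then α i else β i) * (sgn (∑ i, x i * y i) : R) =
      ∏ i, (α i + β i * sgn (x i)) := by
  have h : ∀ i, α i + β i * (sgn (x i) : R) =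
      ∑ a : ZMod 2, (if a = 0 then α i else β i) * (sgn (x i * a) : R) := fun i => by
    rw [show (Finset.univ : Finset (ZMod 2)) = {0, 1} from rfl, Finset.sum_pair (by decide)]
    simp
  simp_rw [h]
  rw [Finset.prod_univ_sum, Fintype.piFinset_univ]
  refine Finset.sum_congr rfl fun y _ => ?_
  rw [Finset.prod_mul_distrib, sgn_sum, Int.cast_prod]

theorem card_supp (y : Fin n → ZMod 2) : (supp y).card = hammingNorm y := rfl

theorem mem_supp {y : Fin n → ZMod 2} {i : Fin n} : i ∈ supp y ↔ y i ≠ 0 := by simp [supp]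

theorem prod_ite_eq_pow (T : Finset (Fin n)) (y : Fin n → ZMod 2) :
    (∏ i, if y i = 0 then (if i ∈ T then (0 : ℤ[X]) else 1) else X) =
      if T ⊆ supp y then X ^ hammingNorm y else 0 := by
  split_ifs with h
  · rw [Finset.prod_ite, Finset.prod_const, Finset.prod_eq_one, one_mul]
    · rfl
    · intro i hi
      rw [if_neg]
      exact fun hT => mem_supp.1 (h hT) (Finset.mem_filter.1 hi).2
  · obtain ⟨i, hiT, hi⟩ := Finset.not_subset.1 h
    rw [mem_supp, not_not] at hi
    exact Finset.prod_eq_zero (Finset.mem_univ i) (by rw [if_pos hi, if_pos hiT])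

/-- The transform of the weight enumerator of the vectors whose support contains `T`. -/
theorem card_mul_sum_dual (C : BinaryCode n) (T : Finset (Fin n)) :
    (C.words.card : ℤ[X]) * ∑ y ∈ C.dual.words, (if T ⊆ supp y then X ^ hammingNorm y else 0) =
      ∑ x ∈ C.words, ∏ i, ((if i ∈ T then (0 : ℤ[X]) else 1) + X * (sgn (x i) : ℤ[X])) := by
  rw [← sum_words_transform]
  refine Finset.sum_congr rfl fun x _ => ?_
  rw [← sum_prod_mul_sgn]
  exact Finset.sum_congr rfl fun y _ => by rw [prod_ite_eq_pow]

theorem prod_one_add_sgn (x : Fin n → ZMod 2) :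
    ∏ i, (1 + X * (sgn (x i) : ℤ[X])) =
      (1 - X) ^ hammingNorm x * (1 + X) ^ (n - hammingNorm x) := by
  have h : ∀ i, 1 + X * (sgn (x i) : ℤ[X]) = if x i ≠ 0 then 1 - X else 1 + X := fun i => by
    by_cases hi : x i = 0 <;> simp [sgn, hi, sub_eq_add_neg]
  simp_rw [h]
  rw [Finset.prod_ite, Finset.prod_const, Finset.prod_const]
  congr 2
  rw [Finset.filter_not, Finset.card_sdiff_of_subset (Finset.filter_subset _ _), Finset.card_univ,
    Fintype.card_fin]
  rfl

/-- For `s = ±1` one has `(1 - X ^ 2) * s = (s - X) * (1 + X * s)`. Multiplying by `(1 - X ^ 2) ^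
T.card` therefore replaces the missing factors at `T` and leaves the full product, which depends
only on the weight of `x`. -/
theorem pow_mul_prod_sgn (T : Finset (Fin n)) (x : Fin n → ZMod 2) :
    (1 - X ^ 2) ^ T.card * ∏ i, ((if i ∈ T then (0 : ℤ[X]) else 1) + X * (sgn (x i) : ℤ[X])) =
      (∏ i ∈ T, (X * ((sgn (x i) : ℤ[X]) - X))) *
        ((1 - X) ^ hammingNorm x * (1 + X) ^ (n - hammingNorm x)) := by
  rw [← prod_one_add_sgn, ← Finset.prod_const, ← Fintype.prod_ite_mem T, ← Fintype.prod_ite_mem T,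
    ← Finset.prod_mul_distrib, ← Finset.prod_mul_distrib]
  refine Finset.prod_congr rfl fun i _ => ?_
  have h : (sgn (x i) : ℤ[X]) * sgn (x i) = 1 := by
    rw [← Int.cast_mul, sgn_mul_self, Int.cast_one]
  split_ifs
  · linear_combination -X ^ 2 * h
  · ring

theorem supp_injective : Function.Injective (supp : (Fin n → ZMod 2) → Finset (Fin n)) := by
  intro x y h
  funext i
  have hi := Finset.ext_iff.1 h i
  rw [mem_supp, mem_supp] at hi
  revert hi
  generalize x i = a
  generalize y i = b
  revert a b
  decide

theorem supportBlocks_eq_image (C : BinaryCode n) (w : ℕ) :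
    C.supportBlocks w = (C.wordsOf w).image supp := by
  classical
  ext b
  simp [supportBlocks, and_assoc]

theorem card_filter_supportBlocks (C : BinaryCode n) (w : ℕ) (T : Finset (Fin n)) :
    ((C.supportBlocks w).filter (fun b => T ⊆ b)).card =
      ((C.wordsOf w).filter (fun y => T ⊆ supp y)).card := by
  rw [supportBlocks_eq_image, Finset.filter_image,
    Finset.card_image_of_injective _ supp_injective]

theorem coeff_sum_ite (C : BinaryCode n) (w : ℕ) (T : Finset (Fin n)) :
    (∑ y ∈ C.words, (if T ⊆ supp y then (X : ℤ[X]) ^ hammingNorm y else 0)).coeff w =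
      ((C.supportBlocks w).filter (fun b => T ⊆ b)).card := by
  rw [card_filter_supportBlocks, finsetSum_coeff, wordsOf, Finset.filter_filter,
    Finset.card_filter, Nat.cast_sum]
  refine Finset.sum_congr rfl fun y _ => ?_
  by_cases h1 : T ⊆ supp y <;> by_cases h2 : hammingNorm y = w <;>
    simp [h1, h2, coeff_X_pow, eq_comm]
  exact fun h => absurd h.symm h2

end

/-! ### Codes with three inner weights: complementation and moments -/

section

variable {n : ℕ}

theorem hammingNorm_le (x : Fin n → ZMod 2) : hammingNorm x ≤ n := by
  simpa using hammingNorm_le_card_fintype (x := x)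

theorem hammingNorm_one : hammingNorm (1 : Fin n → ZMod 2) = n := by simp [hammingNorm]

theorem hammingNorm_add_one (x : Fin n → ZMod 2) : hammingNorm (x + 1) = n - hammingNorm x := by
  have h : supp (x + 1) = (supp x)ᶜ := by
    ext i
    rw [Finset.mem_compl, mem_supp, mem_supp, Pi.add_apply, Pi.one_apply]
    generalize x i = a
    revert a; decide
  rw [← card_supp, h, Finset.card_compl, Fintype.card_fin, card_supp]

theorem add_one_add_one (x : Fin n → ZMod 2) : x + 1 + 1 = x := by
  funext i
  rw [Pi.add_apply, Pi.add_apply, Pi.one_apply, add_assoc, CharTwo.add_self_eq_zero, add_zero]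

theorem sum_sgn (x : Fin n → ZMod 2) : ∑ i, sgn (x i) = n - 2 * hammingNorm x := by
  have h : ∀ i, sgn (x i) = 1 - 2 * if x i ≠ 0 then 1 else 0 := fun i => by
    by_cases hi : x i = 0 <;> simp [sgn, hi]
  simp_rw [h]
  rw [Finset.sum_sub_distrib, ← Finset.mul_sum, Finset.sum_boole]
  simp [hammingNorm]

variable {C : BinaryCode n} {d N : ℕ}

theorem sub_mem_lowWeights (h : (1 : Fin n → ZMod 2) ∈ C) {u : ℕ} (hu : u ∈ C.lowWeights 1) :
    n - u ∈ C.lowWeights 1 := by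
  obtain ⟨h0, hn, c, hc, rfl⟩ := hu
  exact ⟨by omega, by omega, c + 1, C.add_mem hc h, hammingNorm_add_one c⟩

/-- The middle one of the three weights is half the length. -/
theorem IsAssmusMattson.exists_half (h : C.IsAssmusMattson d 4 1) (hd : 2 * d < n) :
    ∃ N, n = 2 * N ∧ 0 < d ∧ C.lowWeights 1 = {d, N, n - d} := by
  obtain ⟨c, hc, hc0, hcd⟩ := h.minDist.1
  have hd0 : 0 < d := by
    rw [← hcd]; exact Nat.pos_of_ne_zero (by simpa [hammingNorm_eq_zero] using hc0)
  have h1 : d ∈ C.lowWeights 1 := ⟨hd0, by omega, c, hc, hcd⟩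
  have h2 := sub_mem_lowWeights h.one_mem h1
  have h3 : ({d, n - d} : Set ℕ).ncard < (C.lowWeights 1).ncard := by
    rw [h.card_weights, Set.ncard_pair (by omega)]; norm_num
  obtain ⟨v, hv, hvn⟩ := Set.exists_mem_notMem_of_ncard_lt_ncard h3
  simp only [Set.mem_insert_iff, Set.mem_singleton_iff, not_or] at hvn
  have hfin : (C.lowWeights 1).Finite :=
    Set.finite_of_ncard_pos (by rw [h.card_weights]; norm_num)
  have heq : ({d, v, n - d} : Set ℕ) = C.lowWeights 1 := by
    refine Set.eq_of_subset_of_ncard_le ?_ ?_ hfin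
    · rintro u (rfl | rfl | rfl) <;> assumption
    · rw [h.card_weights, Set.ncard_insert_of_notMem, Set.ncard_pair hvn.2]
      simp only [Set.mem_insert_iff, Set.mem_singleton_iff, not_or]
      exact ⟨fun hh => hvn.1 hh.symm, by omega⟩
  -- The complementary weight `n - v` cannot be `d` or `n - d`, since `v` is neither, so `n - v =
  -- v`.
  have h4 := sub_mem_lowWeights h.one_mem hv
  have hvle : 0 < v ∧ v + 1 ≤ n := ⟨hv.1, hv.2.1⟩
  rw [← heq] at h4
  refine ⟨v, ?_, hd0, heq.symm⟩
  rcases h4 with h4 | h4 | h4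
  · omega
  · omega
  · rw [Set.mem_singleton_iff] at h4; omega

/-- `C` contains the all-ones vector, has dual distance at least `3`, and its nonzero weights are
`d`, `N`, `n - d` and `n = 2 * N`, with `0 < d < N`. -/
structure IsThreeWeight (C : BinaryCode n) (d N : ℕ) : Prop where
  length : n = 2 * N
  pos : 0 < d
  lt : d < N
  one_mem : (1 : Fin n → ZMod 2) ∈ C
  weights : ∀ x ∈ C, hammingNorm x = 0 ∨ hammingNorm x = n ∨ hammingNorm x = d ∨
    hammingNorm x = n - d ∨ hammingNorm x = N
  dual_weights : ∀ y ∈ C.dual, y ≠ 0 → 3 ≤ hammingNorm y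

theorem IsAssmusMattson.isThreeWeight (h : C.IsAssmusMattson d 4 1) (hn : n = 2 * N)
    (hd : d < N) : C.IsThreeWeight d N := by
  obtain ⟨N', hN', hd0, hw⟩ := h.exists_half (by omega)
  obtain rfl : N' = N := by omega
  refine ⟨hn, hd0, hd, h.one_mem, fun x hx => ?_, fun y hy hy0 => ?_⟩
  · by_cases h0 : hammingNorm x = 0
    · exact Or.inl h0
    by_cases h1 : hammingNorm x = n
    · exact Or.inr (Or.inl h1)
    have : hammingNorm x ∈ C.lowWeights 1 :=
      ⟨by omega, by have := hammingNorm_le x; omega, x, hx, rfl⟩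
    rw [hw] at this
    simp only [Set.mem_insert_iff, Set.mem_singleton_iff] at this
    tauto
  · have := h.dual_minDist.2 ⟨y, hy, hy0, rfl⟩
    omega

theorem IsAssmusMattson.wordsOf_nonempty (h : C.IsAssmusMattson d 4 1) (hn : n = 2 * N)
    (hd : d < N) : (C.wordsOf d).Nonempty ∧ (C.wordsOf N).Nonempty := by
  obtain ⟨N', hN', hd0, hw⟩ := h.exists_half (by omega)
  obtain rfl : N' = N := by omega
  have h1 : d ∈ C.lowWeights 1 := by rw [hw]; simp
  have h2 : N' ∈ C.lowWeights 1 := by rw [hw]; simp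
  obtain ⟨-, -, x, hx, hxd⟩ := h1
  obtain ⟨-, -, y, hy, hyN⟩ := h2
  exact ⟨⟨x, mem_wordsOf.2 ⟨hx, hxd⟩⟩, ⟨y, mem_wordsOf.2 ⟨hy, hyN⟩⟩⟩

namespace IsThreeWeight

variable (h : C.IsThreeWeight d N)
include h

/-- Sums over the code, split by weight. -/
theorem sum_words {M : Type*} [AddCommMonoid M] (g : (Fin n → ZMod 2) → M) :
    ∑ x ∈ C.words, g x =
      g 0 + (g 1 + (∑ x ∈ C.wordsOf d, (g x + g (x + 1)) + ∑ x ∈ C.wordsOf N, g x)) := by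
  have hn := h.length
  have hd := h.pos
  have hl := h.lt
  have hmaps : ∀ x ∈ C.words, hammingNorm x ∈ ({0, n, d, n - d, N} : Finset ℕ) := fun x hx => by
    simpa using h.weights x (mem_words.1 hx)
  rw [← Finset.sum_fiberwise_of_maps_to hmaps]
  change ∑ u ∈ _, ∑ x ∈ C.wordsOf u, g x = _
  rw [Finset.sum_insert (by simp; omega), Finset.sum_insert (by simp; omega),
    Finset.sum_insert (by simp; omega), Finset.sum_insert (by simp; omega), Finset.sum_singleton]
  have h0 : C.wordsOf 0 = {0} := by
    ext x
    simp only [mem_wordsOf, Finset.mem_singleton, hammingNorm_eq_zero]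
    exact ⟨fun hx => hx.2, fun hx => ⟨hx ▸ C.zero_mem, hx⟩⟩
  have h1 : C.wordsOf n = {1} := by
    ext x
    simp only [mem_wordsOf, Finset.mem_singleton]
    constructor
    · rintro ⟨-, hx⟩
      have : x + 1 = 0 := by rw [← hammingNorm_eq_zero, hammingNorm_add_one, hx, Nat.sub_self]
      rw [← add_one_add_one x, this, zero_add]
    · rintro rfl
      exact ⟨h.one_mem, hammingNorm_one⟩
  have h2 : ∑ x ∈ C.wordsOf (n - d), g x = ∑ x ∈ C.wordsOf d, g (x + 1) := by
    refine Finset.sum_bij' (fun x _ => x + 1) (fun x _ => x + 1) ?_ ?_ ?_ ?_ ?_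
    · intro x hx
      rw [mem_wordsOf] at hx ⊢
      exact ⟨C.add_mem hx.1 h.one_mem, by rw [hammingNorm_add_one, hx.2]; omega⟩
    · intro x hx
      rw [mem_wordsOf] at hx ⊢
      exact ⟨C.add_mem hx.1 h.one_mem, by rw [hammingNorm_add_one, hx.2]⟩
    · intro x _; exact add_one_add_one x
    · intro x _; exact add_one_add_one x
    · intro x _; rw [add_one_add_one]
  rw [h0, h1, h2, Finset.sum_singleton, Finset.sum_singleton, Finset.sum_add_distrib]
  abel

/-- The unit vector at `i` has weight 1 and so lies outside the dual; its character sums to zero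
over `C`. The next lemma uses vectors of weight 2 in the same way. -/
theorem sum_words_sgn (i : Fin n) : ∑ x ∈ C.words, sgn (x i) = 0 := by
  have hy : Pi.single i 1 ∉ C.dual := fun hm => by
    have := h.dual_weights _ hm (by simp)
    have h2 : hammingNorm (Pi.single i 1 : Fin n → ZMod 2) ≤ 1 := by
      rw [← card_supp]
      refine (Finset.card_le_card (t := {i}) fun j hj => ?_).trans_eq (Finset.card_singleton i)
      by_contra hji
      exact mem_supp.1 hj (by simp_all)
    omega
  simpa [Pi.single_apply] using sum_words_sgn_of_not_mem hy

theorem sum_words_sgn_mul_sgn {i j : Fin n} (hij : i ≠ j) :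
    ∑ x ∈ C.words, sgn (x i) * sgn (x j) = 0 := by
  have hy : Pi.single i 1 + Pi.single j 1 ∉ C.dual := fun hm => by
    have := h.dual_weights _ hm fun h0 => by
      have := congrFun h0 i
      simp [hij] at this
    have h2 : hammingNorm (Pi.single i 1 + Pi.single j 1 : Fin n → ZMod 2) ≤ 2 := by
      rw [← card_supp]
      refine (Finset.card_le_card (t := {i, j}) fun l hl => ?_).trans Finset.card_le_two
      by_contra hlij
      refine mem_supp.1 hl ?_
      simp only [Finset.mem_insert, Finset.mem_singleton, not_or] at hlij
      simp [hlij.1, hlij.2]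
    omega
  simpa [Pi.single_apply, mul_add, Finset.sum_add_distrib, sgn_add] using
    sum_words_sgn_of_not_mem hy

/-- By pairwise orthogonality of the coordinate signs only the diagonal term `j = i` survives. -/
theorem sum_words_sgn_mul_sum_sgn (i : Fin n) :
    ∑ x ∈ C.words, sgn (x i) * ∑ j, sgn (x j) = C.words.card := by
  simp_rw [Finset.mul_sum]
  rw [Finset.sum_comm, Finset.sum_eq_single i]
  · simp [sgn_mul_self]
  · intro j _ hj
    exact h.sum_words_sgn_mul_sgn hj.symm
  · simp

omit h in
theorem sgn_add_one (x : Fin n → ZMod 2) (i : Fin n) : sgn ((x + 1) i) = -sgn (x i) := by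
  rw [Pi.add_apply, Pi.one_apply, sgn_add, sgn_one]; ring

/-- A sign changes under complementation, so `0` cancels against `1` and weight `d` against weight
`n - d`. -/
theorem sum_half_sgn (i : Fin n) : ∑ x ∈ C.wordsOf N, sgn (x i) = 0 := by
  have := h.sum_words_sgn i
  rw [h.sum_words] at this
  simpa [sgn_add_one, sgn_add] using this

/-- A product of two signs is invariant under complementation, so the other four weights contribute
in equal pairs. This eliminates the words of weight `N` in favour of those of weight `d`. -/
theorem sum_half_sgn_mul_sgn {i j : Fin n} (hij : i ≠ j) :
    ∑ x ∈ C.wordsOf N, sgn (x i) * sgn (x j) =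
      -2 - 2 * ∑ x ∈ C.wordsOf d, sgn (x i) * sgn (x j) := by
  have := h.sum_words_sgn_mul_sgn hij
  rw [h.sum_words] at this
  simp only [sgn_add_one, Pi.zero_apply, Pi.one_apply, sgn_zero, sgn_one,
    Finset.sum_add_distrib, neg_mul_neg] at this
  linarith

/-- The sum of all signs of `x` is `n - 2 * hammingNorm x`, which kills the words of weight `N` in
`sum_words_sgn_mul_sum_sgn`. The sum of signs over the words of weight `d` is thus the same at every
coordinate. -/
theorem sum_minimum_sgn (i : Fin n) :
    2 * (n - 2 * d) * ∑ x ∈ C.wordsOf d, sgn (x i) = C.words.card - 2 * (n : ℤ) := by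
  have := h.sum_words_sgn_mul_sum_sgn i
  rw [h.sum_words] at this
  simp only [sum_sgn] at this
  simp only [sgn_add_one, hammingNorm_add_one, hammingNorm_zero, hammingNorm_one,
    Pi.zero_apply, Pi.one_apply, sgn_zero, sgn_one] at this
  have h1 : ∑ x ∈ C.wordsOf d, (sgn (x i) * ((n : ℤ) - 2 * hammingNorm x) +
      -sgn (x i) * ((n : ℤ) - 2 * ((n - hammingNorm x : ℕ) : ℤ))) =
      ∑ x ∈ C.wordsOf d, 2 * (n - 2 * d) * sgn (x i) :=
    Finset.sum_congr rfl fun x hx => by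
      rw [(mem_wordsOf.1 hx).2, Nat.cast_sub (by have := h.length; have := h.lt; omega)]; ring
  have h2 : ∑ x ∈ C.wordsOf N, sgn (x i) * ((n : ℤ) - 2 * hammingNorm x) = 0 :=
    Finset.sum_eq_zero fun x hx => by
      rw [(mem_wordsOf.1 hx).2, h.length]; push_cast; ring
  rw [h1, h2, ← Finset.mul_sum] at this
  push_cast at this
  linarith

theorem sum_minimum_sgn_eq (i j : Fin n) :
    ∑ x ∈ C.wordsOf d, sgn (x i) = ∑ x ∈ C.wordsOf d, sgn (x j) := by
  have h0 : (2 * ((n : ℤ) - 2 * d)) ≠ 0 := by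
    have := h.length; have := h.lt; omega
  exact mul_left_cancel₀ h0 ((h.sum_minimum_sgn i).trans (h.sum_minimum_sgn j).symm)

theorem card_words_eq : (C.words.card : ℤ) = 2 + 2 * (C.wordsOf d).card + (C.wordsOf N).card := by
  have := h.sum_words fun _ => (1 : ℤ)
  simp only [Finset.sum_const, nsmul_eq_mul] at this
  linarith

/-- This is the second power moment. It determines the number of words of weight `d` from `n`, `d`
and the size of the code. -/
theorem card_minimum_mul :
    2 * (n : ℤ) ^ 2 + 2 * (C.wordsOf d).card * (n - 2 * d) ^ 2 = n * C.words.card := by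
  have h1 : ∑ x ∈ C.words, (∑ i, sgn (x i)) * ∑ j, sgn (x j) = n * C.words.card := by
    simp_rw [Finset.sum_mul _ _ (∑ j, _)]
    rw [Finset.sum_comm, Finset.sum_congr rfl fun i _ => h.sum_words_sgn_mul_sum_sgn i]
    simp
  rw [h.sum_words] at h1
  simp only [sum_sgn, hammingNorm_add_one, hammingNorm_zero, hammingNorm_one] at h1
  have h2 : ∑ x ∈ C.wordsOf d, (((n : ℤ) - 2 * hammingNorm x) * ((n : ℤ) - 2 * hammingNorm x) +
      ((n : ℤ) - 2 * ((n - hammingNorm x : ℕ) : ℤ)) *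
        ((n : ℤ) - 2 * ((n - hammingNorm x : ℕ) : ℤ))) =
      ∑ x ∈ C.wordsOf d, 2 * ((n : ℤ) - 2 * d) ^ 2 :=
    Finset.sum_congr rfl fun x hx => by
      rw [(mem_wordsOf.1 hx).2, Nat.cast_sub (by have := h.length; have := h.lt; omega)]; ring
  have h3 : ∑ x ∈ C.wordsOf N,
      ((n : ℤ) - 2 * hammingNorm x) * ((n : ℤ) - 2 * hammingNorm x) = 0 :=
    Finset.sum_eq_zero fun x hx => by
      rw [(mem_wordsOf.1 hx).2, h.length]; push_cast; ring
  rw [h2, h3, Finset.sum_const, nsmul_eq_mul] at h1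
  push_cast at h1
  linarith

end IsThreeWeight

end

/-! ### Coefficients of the enumerators and the criterion for 2-designs -/

section

/-- The polynomial `∑ j, (2 h choose 2 j) X ^ j`. -/
noncomputable def evenBinomial (h : ℕ) : ℤ[X] :=
  ∑ j ∈ Finset.range (h + 1), C ((2 * h).choose (2 * j) : ℤ) * X ^ j

theorem coeff_evenBinomial (h j : ℕ) : (evenBinomial h).coeff j = (2 * h).choose (2 * j) := by
  simp only [evenBinomial, finsetSum_coeff, coeff_C_mul, coeff_X_pow]
  simp only [mul_ite, mul_one, mul_zero, Finset.sum_ite_eq, Finset.mem_range]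
  split_ifs with hj
  · rfl
  · rw [Nat.choose_eq_zero_of_lt (by omega), Nat.cast_zero]

theorem coeff_one_sub_X_pow (d i : ℕ) : ((1 - X : ℤ[X]) ^ d).coeff i = (-1) ^ i * d.choose i := by
  have h : (1 - X : ℤ[X]) ^ d = ((1 + X) ^ d).comp (C (-1) * X) := by
    simp [sub_eq_add_neg]
  rw [h, comp_C_mul_X_coeff, coeff_one_add_X_pow, mul_comm]

theorem one_add_X_pow_add_one_sub_X_pow (h : ℕ) :
    (1 + X : ℤ[X]) ^ (2 * h) + (1 - X) ^ (2 * h) = expand ℤ 2 (2 * evenBinomial h) := by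
  ext i
  rw [coeff_add, coeff_one_sub_X_pow, coeff_one_add_X_pow, coeff_expand (by norm_num)]
  split_ifs with hi
  · obtain ⟨j, rfl⟩ := hi
    rw [Nat.mul_div_cancel_left _ (by norm_num), ← C_ofNat, coeff_C_mul, coeff_evenBinomial,
      pow_mul]
    norm_num
    ring
  · rw [Odd.neg_one_pow (Nat.not_even_iff_odd.1 fun he => hi he.two_dvd)]
    ring

theorem expand_one_sub_X_pow (d : ℕ) : expand ℤ 2 ((1 - X) ^ d) = (1 - X ^ 2) ^ d := by simp

theorem pow_mul_pow_half (N : ℕ) :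
    (1 - X : ℤ[X]) ^ N * (1 + X) ^ N = expand ℤ 2 ((1 - X) ^ N) := by
  rw [expand_one_sub_X_pow, ← mul_pow]; ring

theorem pow_mul_pow_add_symm (d h : ℕ) :
    (1 - X : ℤ[X]) ^ d * (1 + X) ^ (d + 2 * h) + (1 - X) ^ (d + 2 * h) * (1 + X) ^ d =
      expand ℤ 2 ((1 - X) ^ d * (2 * evenBinomial h)) := by
  rw [map_mul, ← one_add_X_pow_add_one_sub_X_pow, ← pow_mul_pow_half]; ring

/-- The `m`-th coefficient of `(1 - X) ^ d * evenBinomial h`. -/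
theorem coeff_pow_mul_evenBinomial (d h m : ℕ) :
    ((1 - X : ℤ[X]) ^ d * evenBinomial h).coeff m = ∑ j ∈ Finset.range (h + 1),
      if j ≤ m then (-1) ^ (m - j) * (d.choose (m - j) : ℤ) * (2 * h).choose (2 * j) else 0 := by
  rw [evenBinomial, Finset.mul_sum, finsetSum_coeff]
  refine Finset.sum_congr rfl fun j _ => ?_
  rw [← mul_assoc, coeff_mul_X_pow', coeff_mul_C, coeff_one_sub_X_pow]

/-- Up to a factor independent of `j`, the binomial coefficient becomes a product of `h` numbers,
which is cheap to evaluate when `h` is small compared with `M`. Both sides vanish if `m - j > M`. -/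
theorem choose_sub_mul_factorial {M h m j : ℕ} (hj : j ≤ h) (hm : m ≤ M + h) (hjm : j ≤ m) :
    M.choose (m - j) * (m.factorial * (M + h - m).factorial) =
      M.factorial * (m.descFactorial j * (M + h - m).descFactorial (h - j)) := by
  by_cases hM : m - j ≤ M
  · rw [← Nat.factorial_mul_descFactorial hjm,
      ← Nat.factorial_mul_descFactorial (show h - j ≤ M + h - m by omega),
      ← Nat.choose_mul_factorial_mul_factorial hM,
      show M + h - m - (h - j) = M - (m - j) by omega]
    ring
  · rw [Nat.choose_eq_zero_of_lt (by omega),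
      Nat.descFactorial_eq_zero_iff_lt.2 (show M + h - m < h - j by omega)]
    ring

/-- A criterion for the vanishing of a coefficient of `(1 - X) ^ M * P`, without large binomial
coefficients. -/
theorem coeff_pow_mul_eq_zero {P : ℤ[X]} {M h m : ℕ} (hP : P.natDegree ≤ h) (hm : m ≤ M + h)
    (hs : ∑ j ∈ Finset.range (h + 1), (-1) ^ j * P.coeff j *
      (m.descFactorial j * (M + h - m).descFactorial (h - j) : ℕ) = 0) :
    ((1 - X) ^ M * P).coeff m = 0 := by
  have h0 : ((m.factorial * (M + h - m).factorial : ℕ) : ℤ) ≠ 0 := by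
    exact_mod_cast (Nat.mul_pos (Nat.factorial_pos _) (Nat.factorial_pos _)).ne'
  refine (mul_eq_zero.1 ?_).resolve_right h0
  rw [P.as_sum_range' (h + 1) (by omega), Finset.mul_sum, finsetSum_coeff, Finset.sum_mul,
    ← mul_zero ((M.factorial : ℤ) * (-1) ^ m), ← hs, Finset.mul_sum]
  refine Finset.sum_congr rfl fun j hj => ?_
  rw [← C_mul_X_pow_eq_monomial, ← mul_assoc, coeff_mul_X_pow', coeff_mul_C,
    coeff_one_sub_X_pow]
  split_ifs with hjm
  · have h1 := choose_sub_mul_factorial (by simpa [Nat.lt_succ_iff] using hj) hm hjm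
    have h2 : ((M.choose (m - j) * (m.factorial * (M + h - m).factorial) : ℕ) : ℤ) =
      (M.factorial * (m.descFactorial j * (M + h - m).descFactorial (h - j)) : ℕ) :=
      congrArg _ h1
    have h3 : (-1 : ℤ) ^ m = (-1) ^ (m - j) * (-1) ^ j := by
      rw [← pow_add, Nat.sub_add_cancel hjm]
    have h4 : (-1 : ℤ) ^ j * (-1) ^ j = 1 := by rw [← mul_pow]; norm_num
    rw [h3]
    push_cast at h2 ⊢
    linear_combination ((-1) ^ (m - j) * P.coeff j) * h2 - (M.factorial *
      (-1) ^ (m - j) * P.coeff j * (m.descFactorial j * (M + h - m).descFactorial (h - j))) * h4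
  · rw [Nat.descFactorial_eq_zero_iff_lt.2 (by omega)]
    simp

/-- Binomial coefficients as quotients, for fast evaluation. -/
def quickChoose (n k : ℕ) : ℕ := n.descFactorial k / k.factorial

theorem quickChoose_eq (n k : ℕ) : quickChoose n k = n.choose k :=
  (Nat.choose_eq_descFactorial_div_factorial n k).symm

/-- `∑ j ∈ range k, f j` by recursion. -/
def sumTo (f : ℕ → ℤ) : ℕ → ℤ
  | 0 => 0
  | k + 1 => sumTo f k + f k

theorem sumTo_eq (f : ℕ → ℤ) (k : ℕ) : sumTo f k = ∑ j ∈ Finset.range k, f j := by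
  induction k with
  | zero => rfl
  | succ k ih => rw [sumTo, ih, Finset.sum_range_succ]

/-- The test that `(1 - X) ^ M * (evenBinomial h - (1 - X) ^ h)` has zero `m`-th coefficient. -/
def coeffZeroTest (M h m : ℕ) : Bool :=
  Nat.ble m (M + h) && sumTo (fun j => bif Nat.blt m j || Nat.blt (M + j) m then 0 else
    (-1) ^ j * ((quickChoose (2 * h) (2 * j) : ℤ) - (-1) ^ j * quickChoose h j) *
      (m.descFactorial j * (M + h - m).descFactorial (h - j) : ℕ)) (h + 1) == 0

theorem coeff_eq_zero_of_test {M h m : ℕ} (ht : coeffZeroTest M h m = true) :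
    ((1 - X) ^ M * (evenBinomial h - (1 - X) ^ h)).coeff m = 0 := by
  simp only [coeffZeroTest, Bool.and_eq_true, Nat.ble_eq, beq_iff_eq, sumTo_eq,
    quickChoose_eq] at ht
  refine coeff_pow_mul_eq_zero (h := h) ?_ ht.1 ?_
  · rw [natDegree_le_iff_coeff_eq_zero]
    intro j hj
    rw [coeff_sub, coeff_evenBinomial, coeff_one_sub_X_pow, Nat.choose_eq_zero_of_lt (by omega),
      Nat.choose_eq_zero_of_lt hj]
    simp
  · rw [← ht.2]
    refine Finset.sum_congr rfl fun j hj => ?_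
    rw [coeff_sub, coeff_evenBinomial, coeff_one_sub_X_pow]
    rw [Finset.mem_range] at hj
    by_cases h1 : m < j
    · simp [Nat.descFactorial_eq_zero_iff_lt.2 h1]
    by_cases h2 : M + j < m
    · simp [Nat.descFactorial_eq_zero_iff_lt.2 (show M + h - m < h - j by omega)]
    · have h3 : (Nat.blt m j || Nat.blt (M + j) m) = false := by
        rw [Bool.eq_false_iff, Ne, Bool.or_eq_true, Nat.blt_eq, Nat.blt_eq]; omega
      rw [h3, cond_false]

variable {n : ℕ} {C : BinaryCode n} {d N : ℕ}

namespace IsThreeWeight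

/-- The MacWilliams identity for the weights at hand. -/
theorem card_mul_card_supportBlocks (h : C.IsThreeWeight d N) (m : ℕ) :
    (C.words.card : ℤ) * (C.dual.supportBlocks (2 * m)).card =
      2 * n.choose (2 * m) +
      2 * (C.wordsOf d).card * ((1 - X : ℤ[X]) ^ d * evenBinomial (N - d)).coeff m +
      (C.wordsOf N).card * ((-1) ^ m * N.choose m) := by
  have hn := h.length
  have hd := h.lt
  -- The empty `T` gives the full weight enumerator of the dual.
  have h1 := card_mul_sum_dual C ∅
  simp only [Finset.notMem_empty, if_false, Finset.empty_subset, if_true, prod_one_add_sgn] at h1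
  rw [h.sum_words] at h1
  simp only [hammingNorm_add_one, hammingNorm_zero, hammingNorm_one] at h1
  have h2 : ∑ x ∈ C.wordsOf d, ((1 - X : ℤ[X]) ^ hammingNorm x * (1 + X) ^ (n - hammingNorm x) +
      (1 - X) ^ (n - hammingNorm x) * (1 + X) ^ (n - (n - hammingNorm x))) =
      (C.wordsOf d).card * expand ℤ 2 ((1 - X) ^ d * (2 * evenBinomial (N - d))) := by
    rw [← pow_mul_pow_add_symm, ← nsmul_eq_mul]
    refine Finset.sum_eq_card_nsmul fun x hx => ?_
    rw [(mem_wordsOf.1 hx).2, show n - (n - d) = d by omega,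
      show d + 2 * (N - d) = n - d by omega]
  have h3 : ∑ x ∈ C.wordsOf N, (1 - X : ℤ[X]) ^ hammingNorm x * (1 + X) ^ (n - hammingNorm x) =
      (C.wordsOf N).card * expand ℤ 2 ((1 - X) ^ N) := by
    rw [← pow_mul_pow_half, ← nsmul_eq_mul]
    refine Finset.sum_eq_card_nsmul fun x hx => ?_
    rw [(mem_wordsOf.1 hx).2, show n - N = N by omega]
  have h4 : (1 - X : ℤ[X]) ^ 0 * (1 + X) ^ (n - 0) + (1 - X) ^ n * (1 + X) ^ (n - n) =
      expand ℤ 2 (2 * evenBinomial N) := by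
    rw [← one_add_X_pow_add_one_sub_X_pow, hn]; simp
  rw [h2, h3, ← add_assoc, h4] at h1
  have h5 := congrArg (fun p => coeff p (2 * m)) h1
  have h6 := coeff_sum_ite C.dual (2 * m) ∅
  simp only [Finset.empty_subset, if_true, Finset.filter_true] at h6
  simp only [← C_eq_natCast, coeff_add, coeff_C_mul, mul_comm 2 m,
    coeff_expand_mul (two_pos : 0 < 2)] at h5
  rw [mul_left_comm _ (2 : ℤ[X]), ← C_ofNat, coeff_C_mul, coeff_C_mul, coeff_evenBinomial,
    coeff_one_sub_X_pow, ← hn] at h5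
  rw [mul_comm m 2, h6] at h5
  linear_combination h5

/-- If a certain coefficient vanishes, then the support design of the dual code is a
`2`-design. -/
theorem isDesign_of_coeff (h : C.IsThreeWeight d N) {M m : ℕ} (hM : d = M + 2)
    (hc : ((1 - X) ^ M * (evenBinomial (N - d) - (1 - X) ^ (N - d))).coeff m = 0) :
    IsDesign 2 (2 * m + 2) (C.dual.supportBlocks (2 * m + 2)) := by
  have hn := h.length
  have hd := h.lt
  refine ⟨by omega, ?_, ?_⟩
  · intro b hb
    rw [supportBlocks_eq_image, Finset.mem_image] at hb
    obtain ⟨y, hy, rfl⟩ := hb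
    rw [card_supp]
    exact (mem_wordsOf.1 hy).2
  set G : Finset (Fin n) → ℤ[X] := fun T =>
    ∑ y ∈ C.dual.words, (if T ⊆ supp y then X ^ hammingNorm y else 0)
  set S : Fin n → Fin n → ℤ := fun i j => ∑ x ∈ C.wordsOf d, sgn (x i) * sgn (x j)
  set R : ℤ := ∑ x ∈ C.wordsOf d, sgn (x ⟨0, by omega⟩)
  -- Only `S i j` depends on the pair on the right-hand side: single signs sum to `R` over weight
  -- `d` and to zero over weight `N`, and products over weight `N` sum to `-2 - 2 * S i j`.
  have hkey : ∀ i j : Fin n, i ≠ j → (1 - X ^ 2) ^ 2 * ((C.words.card : ℤ[X]) * G {i, j}) =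
      X ^ 2 * ((1 - X) ^ 2 * (1 + X) ^ n + (1 + X) ^ 2 * (1 - X) ^ n +
        ((S i j : ℤ[X]) + ((C.wordsOf d).card : ℤ[X]) * X ^ 2) *
          ((1 - X) ^ d * (1 + X) ^ (n - d) + (1 - X) ^ (n - d) * (1 + X) ^ d) -
        2 * X * (R : ℤ[X]) *
          ((1 - X) ^ d * (1 + X) ^ (n - d) - (1 - X) ^ (n - d) * (1 + X) ^ d) +
        (-2 - 2 * (S i j : ℤ[X]) + ((C.wordsOf N).card : ℤ[X]) * X ^ 2) *
          ((1 - X) ^ N * (1 + X) ^ N)) := by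
    intro i j hij
    have h1 : ∀ x : Fin n → ZMod 2, (1 - X ^ 2) ^ 2 * ∏ l,
        ((if l ∈ ({i, j} : Finset (Fin n)) then (0 : ℤ[X]) else 1) + X * (sgn (x l) : ℤ[X])) =
        X ^ 2 * (((sgn (x i) : ℤ[X]) - X) * ((sgn (x j) : ℤ[X]) - X) *
          ((1 - X) ^ hammingNorm x * (1 + X) ^ (n - hammingNorm x))) := fun x => by
      have := pow_mul_prod_sgn {i, j} x
      rw [Finset.card_pair hij, Finset.prod_pair hij] at this
      rw [this]; ring
    rw [card_mul_sum_dual, Finset.mul_sum, Finset.sum_congr rfl fun x _ => h1 x,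
      ← Finset.mul_sum, h.sum_words]
    simp only [hammingNorm_add_one, hammingNorm_zero, hammingNorm_one, sgn_add_one, Pi.zero_apply,
      Pi.one_apply, sgn_zero, sgn_one]
    have h2 : ∑ x ∈ C.wordsOf d, (((sgn (x i) : ℤ[X]) - X) * ((sgn (x j) : ℤ[X]) - X) *
          ((1 - X) ^ hammingNorm x * (1 + X) ^ (n - hammingNorm x)) +
        (((-sgn (x i) : ℤ) : ℤ[X]) - X) * (((-sgn (x j) : ℤ) : ℤ[X]) - X) *
          ((1 - X) ^ (n - hammingNorm x) * (1 + X) ^ (n - (n - hammingNorm x)))) =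
        ((S i j : ℤ[X]) + ((C.wordsOf d).card : ℤ[X]) * X ^ 2) *
          ((1 - X) ^ d * (1 + X) ^ (n - d) + (1 - X) ^ (n - d) * (1 + X) ^ d) -
        2 * X * (R : ℤ[X]) *
          ((1 - X) ^ d * (1 + X) ^ (n - d) - (1 - X) ^ (n - d) * (1 + X) ^ d) := by
      have hR : ∀ l, ∑ x ∈ C.wordsOf d, (sgn (x l) : ℤ[X]) = R := fun l => by
        rw [← Int.cast_sum, h.sum_minimum_sgn_eq l ⟨0, by omega⟩]
      have hS : ∑ x ∈ C.wordsOf d, (sgn (x i) : ℤ[X]) * (sgn (x j) : ℤ[X]) = S i j := by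
        push_cast [S]; rfl
      have h3 : ∀ x ∈ C.wordsOf d, (((sgn (x i) : ℤ[X]) - X) * ((sgn (x j) : ℤ[X]) - X) *
          ((1 - X) ^ hammingNorm x * (1 + X) ^ (n - hammingNorm x)) +
        (((-sgn (x i) : ℤ) : ℤ[X]) - X) * (((-sgn (x j) : ℤ) : ℤ[X]) - X) *
          ((1 - X) ^ (n - hammingNorm x) * (1 + X) ^ (n - (n - hammingNorm x)))) =
        ((sgn (x i) : ℤ[X]) * (sgn (x j) : ℤ[X]) + X ^ 2) *
          ((1 - X) ^ d * (1 + X) ^ (n - d) + (1 - X) ^ (n - d) * (1 + X) ^ d) -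
        ((sgn (x i) : ℤ[X]) + (sgn (x j) : ℤ[X])) * (X * ((1 - X) ^ d * (1 + X) ^ (n - d) -
          (1 - X) ^ (n - d) * (1 + X) ^ d)) := fun x hx => by
        rw [(mem_wordsOf.1 hx).2, show n - (n - d) = d by omega]
        push_cast
        ring
      rw [Finset.sum_congr rfl h3, Finset.sum_sub_distrib, ← Finset.sum_mul, ← Finset.sum_mul,
        Finset.sum_add_distrib, Finset.sum_add_distrib, hR, hR, hS, Finset.sum_const,
        nsmul_eq_mul]
      ring
    have h4 : ∑ x ∈ C.wordsOf N, ((sgn (x i) : ℤ[X]) - X) * ((sgn (x j) : ℤ[X]) - X) *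
          ((1 - X) ^ hammingNorm x * (1 + X) ^ (n - hammingNorm x)) =
        (-2 - 2 * (S i j : ℤ[X]) + ((C.wordsOf N).card : ℤ[X]) * X ^ 2) *
          ((1 - X) ^ N * (1 + X) ^ N) := by
      have hR : ∀ l, ∑ x ∈ C.wordsOf N, (sgn (x l) : ℤ[X]) = 0 := fun l => by
        rw [← Int.cast_sum, h.sum_half_sgn l, Int.cast_zero]
      have hS : ∑ x ∈ C.wordsOf N, (sgn (x i) : ℤ[X]) * (sgn (x j) : ℤ[X]) = -2 - 2 * S i j := by
        have := congrArg (fun z : ℤ => (z : ℤ[X])) (h.sum_half_sgn_mul_sgn hij)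
        push_cast [S] at this ⊢
        exact this
      have h3 : ∀ x ∈ C.wordsOf N, ((sgn (x i) : ℤ[X]) - X) * ((sgn (x j) : ℤ[X]) - X) *
          ((1 - X) ^ hammingNorm x * (1 + X) ^ (n - hammingNorm x)) =
          ((sgn (x i) : ℤ[X]) * (sgn (x j) : ℤ[X]) - ((sgn (x i) : ℤ[X]) + (sgn (x j) : ℤ[X])) * X + X ^ 2) *
            ((1 - X) ^ N * (1 + X) ^ N) := fun x hx => by
        rw [(mem_wordsOf.1 hx).2, show n - N = N by omega]
        ring
      rw [Finset.sum_congr rfl h3, ← Finset.sum_mul, Finset.sum_add_distrib,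
        Finset.sum_sub_distrib, ← Finset.sum_mul, Finset.sum_add_distrib, hR, hR, hS,
        Finset.sum_const, nsmul_eq_mul]
      ring
    rw [h2, h4, Nat.sub_self, Nat.sub_zero]
    push_cast
    ring
  have hdiff : ∀ i j i' j' : Fin n, i ≠ j → i' ≠ j' →
      (C.words.card : ℤ[X]) * (G {i, j} - G {i', j'}) = ((S i j - S i' j' : ℤ) : ℤ[X]) *
        (expand ℤ 2 (2 * ((1 - X) ^ M * (evenBinomial (N - d) - (1 - X) ^ (N - d)))) * X ^ 2) := by
    intro i j i' j' hij hij'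
    have h0 : ((1 - X ^ 2) ^ 2 : ℤ[X]) ≠ 0 := by
      refine pow_ne_zero 2 fun h0 => ?_
      have := congrArg (eval 2) h0
      simp at this
    refine mul_left_cancel₀ h0 ?_
    have h1 := hkey i j hij
    have h2 := hkey i' j' hij'
    have h3 := pow_mul_pow_add_symm d (N - d)
    rw [show d + 2 * (N - d) = n - d by omega] at h3
    have h4 := pow_mul_pow_half N
    -- The factor `(1 - X ^ 2) ^ 2` introduced by the two points splits off because `d = M + 2`.
    have h5 : expand ℤ 2 ((1 - X) ^ d * (2 * evenBinomial (N - d))) -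
        2 * expand ℤ 2 ((1 - X) ^ N) = (1 - X ^ 2) ^ 2 *
          expand ℤ 2 (2 * ((1 - X) ^ M * (evenBinomial (N - d) - (1 - X) ^ (N - d)))) := by
      have h6 : ∀ p : ℤ[X], 2 * expand ℤ 2 p = expand ℤ 2 (2 * p) := fun p => by
        rw [map_mul, map_ofNat]
      rw [h6, ← expand_one_sub_X_pow, ← map_mul, ← map_sub]
      congr 1
      rw [show N = M + 2 + (N - d) by omega, hM, show M + 2 + (N - (M + 2)) - (M + 2) =
        N - (M + 2) by omega]
      ring
    rw [h3, h4] at h1 h2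
    rw [Int.cast_sub]
    linear_combination h1 - h2 + X ^ 2 * ((S i j : ℤ[X]) - S i' j') * h5
  have hcoeff : ∀ i j i' j' : Fin n, i ≠ j → i' ≠ j' →
      (G {i, j}).coeff (2 * m + 2) = (G {i', j'}).coeff (2 * m + 2) := by
    intro i j i' j' hij hij'
    have h1 := congrArg (fun p => coeff p (2 * m + 2)) (hdiff i j i' j' hij hij')
    simp only [← C_eq_natCast, ← C_eq_intCast, coeff_C_mul, coeff_mul_X_pow, coeff_sub] at h1
    rw [mul_comm 2 m, coeff_expand_mul two_pos, ← C_ofNat, coeff_C_mul, hc, mul_zero,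
      mul_zero] at h1
    have h0 : (C.words.card : ℤ) ≠ 0 := by
      rw [card_words]; positivity
    rw [mul_comm 2 m]
    exact sub_eq_zero.1 ((mul_eq_zero.1 h1).resolve_left (by simpa using h0))
  refine ⟨((C.dual.supportBlocks (2 * m + 2)).filter
    (fun b => {⟨0, by omega⟩, ⟨1, by omega⟩} ⊆ b)).card, fun T hT => ?_⟩
  obtain ⟨i, j, hij, rfl⟩ := Finset.card_eq_two.1 hT
  have h1 := hcoeff i j ⟨0, by omega⟩ ⟨1, by omega⟩ hij (by simp)
  simp only [G, coeff_sum_ite] at h1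
  exact_mod_cast h1

end IsThreeWeight

end

/-! ### Counting in designs, the comparison of δ and s, and bounds on the dimension -/

section

variable {n : ℕ}

/-- Count pairs of a point outside `T` and a block containing `T` and that point: `(n - t) * l`
equals the number of blocks through `T` times `k - t`, and `k - t > 0`. -/
theorem IsDesign.of_succ {t k : ℕ} {B : Finset (Finset (Fin n))} (h : IsDesign (t + 1) k B) :
    IsDesign t k B := by
  obtain ⟨htk, hk, l, hl⟩ := h
  refine ⟨by omega, hk, (n - t) * l / (k - t), fun T hT => ?_⟩
  have h1 := Finset.sum_card_bipartiteAbove_eq_sum_card_bipartiteBelow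
    (s := Tᶜ) (t := B.filter (T ⊆ ·)) (fun (i : Fin n) (b : Finset (Fin n)) => i ∈ b)
  have h2 : ∀ i ∈ Tᶜ, (Finset.bipartiteAbove (fun (i : Fin n) (b : Finset (Fin n)) => i ∈ b)
      (B.filter (T ⊆ ·)) i).card = l := fun i hi => by
    rw [← hl (insert i T) (by rw [Finset.card_insert_of_notMem (Finset.mem_compl.1 hi), hT]),
      Finset.bipartiteAbove, Finset.filter_filter]
    congr 1
    ext b
    simp [Finset.insert_subset_iff, and_comm]
  have h3 : ∀ b ∈ B.filter (T ⊆ ·), (Finset.bipartiteBelow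
      (fun (i : Fin n) (b : Finset (Fin n)) => i ∈ b) Tᶜ b).card = k - t := fun b hb => by
    rw [Finset.mem_filter] at hb
    rw [← hk b hb.1, ← hT, ← Finset.card_sdiff_of_subset hb.2, Finset.bipartiteBelow]
    congr 1
    ext i
    simp [and_comm]
  rw [Finset.sum_congr rfl h2, Finset.sum_congr rfl h3, Finset.sum_const, Finset.sum_const,
    Finset.card_compl, Fintype.card_fin, hT, smul_eq_mul, smul_eq_mul] at h1
  rw [h1, Nat.mul_div_cancel _ (by omega)]

theorem IsDesign.of_le {s t k : ℕ} {B : Finset (Finset (Fin n))} (h : IsDesign t k B)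
    (hst : s ≤ t) : IsDesign s k B := by
  induction t, hst using Nat.le_induction with
  | base => exact h
  | succ t _ ih => exact ih h.of_succ

/-- Double counting of pairs of points inside blocks. -/
theorem IsDesign.exists_card_mul {k : ℕ} {B : Finset (Finset (Fin n))} (h : IsDesign 2 k B) :
    ∃ l : ℕ, B.card * k.choose 2 = n.choose 2 * l := by
  obtain ⟨-, hk, l, hl⟩ := h
  refine ⟨l, ?_⟩
  have h1 := Finset.sum_card_bipartiteAbove_eq_sum_card_bipartiteBelow
    (s := Finset.powersetCard 2 (Finset.univ : Finset (Fin n))) (t := B) (fun T b => T ⊆ b)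
  have h2 : ∀ T ∈ Finset.powersetCard 2 (Finset.univ : Finset (Fin n)),
      (Finset.bipartiteAbove (fun T b => T ⊆ b) B T).card = l := fun T hT =>
    hl T (Finset.mem_powersetCard.1 hT).2
  rw [Finset.sum_congr rfl h2, Finset.sum_const,
    Finset.card_powersetCard, Finset.card_univ, Fintype.card_fin, smul_eq_mul] at h1
  rw [h1, ← smul_eq_mul]
  refine (Finset.sum_eq_card_nsmul fun b hb => ?_).symm
  rw [← hk b hb, ← Finset.card_powersetCard, Finset.bipartiteBelow]
  congr 1
  ext T
  simp [Finset.mem_powersetCard, and_comm]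

/-- If some support design is a `2`-design, but the one for weight `w` is not, then `δ < s`. -/
theorem delta_lt_sMax {E : BinaryCode n} {v w : ℕ} (hv : E.IsProperWeight v)
    (hvd : IsDesign 2 v (E.supportBlocks v)) (hw : E.IsProperWeight w)
    (hwd : ¬ IsDesign 2 w (E.supportBlocks w)) : E.delta < E.sMax := by
  have h1 : 2 ≤ E.sMax := by
    -- The set is bounded because `t ≤ u < n`; an unbounded set would have `sSup` equal to 0.
    refine le_csSup ⟨n, ?_⟩ ⟨v, hv, hvd⟩
    rintro t ⟨u, hu, htu⟩
    exact htu.1.trans hu.2.1.le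
  have h2 : E.delta ≤ 1 := by
    have h3 : ∀ t ∈ {t : ℕ | ∀ w, E.IsProperWeight w → IsDesign t w (E.supportBlocks w)}, t ≤ 1 := by
      intro t ht
      by_contra hlt
      exact hwd ((ht w hw).of_le (by omega))
    rcases Set.eq_empty_or_nonempty
      {t : ℕ | ∀ w, E.IsProperWeight w → IsDesign t w (E.supportBlocks w)} with h4 | h4
    · rw [delta, h4, csSup_empty]; exact Nat.zero_le 1
    · exact csSup_le h4 h3
  omega

/-- `|C|` times the number of words of weight `2 * m` of the dual code, when `q = |C|` and `a` is
the number of words of minimum weight. -/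
def scaledDualCount (n d q a m : ℕ) : ℤ :=
  2 * quickChoose n (2 * m) + 2 * a * sumTo (fun j => bif Nat.ble j m then
      (-1) ^ (m - j) * (quickChoose d (m - j) : ℤ) * quickChoose (2 * (n / 2 - d)) (2 * j) else 0)
    (n / 2 - d + 1) + ((q : ℤ) - 2 - 2 * a) * ((-1) ^ m * quickChoose (n / 2) m)

theorem IsThreeWeight.card_mul_eq_scaledDualCount {C : BinaryCode n} {d N : ℕ}
    (h : C.IsThreeWeight d N) (m : ℕ) :
    (C.words.card : ℤ) * (C.dual.supportBlocks (2 * m)).card =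
      scaledDualCount n d C.words.card (C.wordsOf d).card m := by
  have hN : n / 2 = N := by have := h.length; omega
  rw [h.card_mul_card_supportBlocks, coeff_pow_mul_evenBinomial, scaledDualCount, hN]
  simp only [quickChoose_eq, sumTo_eq]
  have h1 : ∀ j, (bif Nat.ble j m then (-1) ^ (m - j) * (d.choose (m - j) : ℤ) *
      (2 * (N - d)).choose (2 * j) else 0) = if j ≤ m then (-1) ^ (m - j) *
        (d.choose (m - j) : ℤ) * (2 * (N - d)).choose (2 * j) else 0 := fun j => by
    by_cases hj : j ≤ m
    · rw [if_pos hj, Nat.ble_eq_true_of_le hj, cond_true]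
    · rw [if_neg hj, Bool.eq_false_iff.2 (mt Nat.le_of_ble_eq_true hj), cond_false]
  simp only [h1]
  have := h.card_words_eq
  rw [show ((C.words.card : ℤ) - 2 - 2 * (C.wordsOf d).card) = (C.wordsOf N).card by linarith]

/-- The dual count for weight `4` without the terms that are multiples of `q`. -/
def dimensionBound (n d : ℕ) : ℤ :=
  ((n : ℤ) - 2 * d) ^ 2 * scaledDualCount n d 0 0 2 - n ^ 2 *
    (scaledDualCount n d 0 1 2 - scaledDualCount n d 0 0 2)

theorem scaledDualCount_affine (n d q a m : ℕ) :
    scaledDualCount n d q a m = scaledDualCount n d 0 0 m +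
      a * (scaledDualCount n d 0 1 m - scaledDualCount n d 0 0 m) +
      q * ((-1) ^ m * (n / 2).choose m) := by
  simp only [scaledDualCount, quickChoose_eq]
  push_cast
  ring

/-- The scaled count of dual words of weight 4 is affine in `q = |C|` and `a`, the number of words
of weight `d`. Multiplying by `2 * (n - 2 * d) ^ 2` and eliminating `a` by the second moment leaves
`2 * dimensionBound n d` modulo `q`. When this number is positive it bounds the dimension. -/
theorem IsThreeWeight.card_words_dvd {C : BinaryCode n} {d N : ℕ} (h : C.IsThreeWeight d N) :
    (C.words.card : ℤ) ∣ 2 * dimensionBound n d := by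
  have h1 := h.card_mul_eq_scaledDualCount 2
  have h2 := h.card_minimum_mul
  rw [scaledDualCount_affine] at h1
  refine ⟨2 * ((n : ℤ) - 2 * d) ^ 2 * (C.dual.supportBlocks (2 * 2)).card -
    n * (scaledDualCount n d 0 1 2 - scaledDualCount n d 0 0 2) -
    2 * ((n : ℤ) - 2 * d) ^ 2 * ((-1) ^ 2 * (n / 2).choose 2), ?_⟩
  rw [dimensionBound]
  linear_combination (-2 * ((n : ℤ) - 2 * d) ^ 2) * h1 -
    (scaledDualCount n d 0 1 2 - scaledDualCount n d 0 0 2) * h2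

/-- For the cardinality `q` and the number `a` of words of minimum weight: the test that a code is
impossible, or that the support designs of the dual code are non-empty for the weights in `W` and
not a `2`-design for weight `4`. -/
def cardTest (n d q a : ℕ) (W : List ℕ) : Bool :=
  2 * (n * n) + 2 * a * ((n - 2 * d) * (n - 2 * d)) != n * q || (Nat.blt a 1 ||
    (Nat.blt q (2 * a + 3) || (scaledDualCount n d q a 2 % q != 0 ||
      (decide (scaledDualCount n d q a 2 ≤ 0) || (decide (scaledDualCount n d q a 3 < 0) ||
        (12 * scaledDualCount n d q a 2 % (q * n * (n - 1) : ℕ) != 0 &&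
          W.all fun w => decide (0 < scaledDualCount n d q a (w / 2))))))))

/-- The test above for all dimensions in question. -/
def dimensionTest (n d : ℕ) (W : List ℕ) : Bool :=
  decide (0 < dimensionBound n d) && (decide (2 * dimensionBound n d < 2 ^ 80) &&
    -- In the two exempted dimensions the forced dual weight distribution has no words of the listed
    -- weights.
    (List.range 80).all fun k => (n == 16 && k == 8) || ((n == 48 && k == 13) ||
      cardTest n d (2 ^ k)
        ((n * 2 ^ k - 2 * (n * n)) / (2 * ((n - 2 * d) * (n - 2 * d)))) W))

set_option maxRecDepth 20000 in
theorem dimensionTest_all :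
    (parameterTable.all fun e => dimensionTest e.1 e.2.1 e.2.2) = true := by decide +kernel

end

/-! ### Application to the table -/

section

theorem weightTest_all :
    (parameterTable.all fun e => e.1 % 2 == 0 && e.2.2.all fun w =>
      Nat.blt 1 w && (Nat.blt w e.1 && (w % 2 == 0 &&
        coeffZeroTest (e.2.1 - 2) (e.1 / 2 - e.2.1) (w / 2 - 1)))) = true := by
  decide +kernel

variable {n : ℕ} {C : BinaryCode n} {d N : ℕ}

theorem isDesign_of_mem_parameterTable {W : List ℕ} (hW : (n, d, W) ∈ parameterTable)
    (h : C.IsThreeWeight d N) {w : ℕ} (hw : w ∈ W) : IsDesign 2 w (C.dual.supportBlocks w) := by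
  have h1 := List.all_eq_true.1 weightTest_all _ hW
  simp only [Bool.and_eq_true, List.all_eq_true, beq_iff_eq, Nat.blt_eq] at h1
  obtain ⟨hw1, -, hw2, ht⟩ := h1.2 w hw
  obtain ⟨-, -, hd, -⟩ := criteria_of_mem_parameterTable hW
  have hN : n / 2 = N := by have := h.length; omega
  rw [hN] at ht
  have := h.isDesign_of_coeff (M := d - 2) (by omega) (coeff_eq_zero_of_test ht)
  rwa [show 2 * (w / 2 - 1) + 2 = w by omega] at this

theorem IsThreeWeight.supportBlocks_nonempty (h : C.IsThreeWeight d N) {w : ℕ} (hw : w % 2 = 0)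
    (hpos : 0 < scaledDualCount n d C.words.card (C.wordsOf d).card (w / 2)) :
    (C.dual.supportBlocks w).Nonempty := by
  rw [← h.card_mul_eq_scaledDualCount, show 2 * (w / 2) = w by omega] at hpos
  rw [← Finset.card_pos]
  exact_mod_cast pos_of_mul_pos_right hpos (Int.natCast_nonneg _)

/-- In a `2`-design with blocks of size 4, each block has 6 pairs of points, so 12 times the number
of blocks is a multiple of `n * (n - 1)`. -/
theorem IsThreeWeight.not_isDesign_four (h : C.IsThreeWeight d N)
    (ht : 12 * scaledDualCount n d C.words.card (C.wordsOf d).card 2 %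
      (C.words.card * n * (n - 1) : ℕ) ≠ 0) : ¬ IsDesign 2 4 (C.dual.supportBlocks 4) := by
  intro hd
  obtain ⟨l, hl⟩ := hd.exists_card_mul
  refine ht (Int.emod_eq_zero_of_dvd ⟨l, ?_⟩)
  rw [← h.card_mul_eq_scaledDualCount]
  have h1 : n.choose 2 * 2 = n * (n - 1) := by
    rw [Nat.choose_two_right, Nat.div_mul_cancel (Nat.even_mul_pred_self n).two_dvd]
  have h2 : 12 * (C.dual.supportBlocks 4).card = n * (n - 1) * l := by
    rw [← h1, mul_right_comm, ← hl]; simp [Nat.choose]; ring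
  have h3 : 12 * (C.words.card * (C.dual.supportBlocks (2 * 2)).card) =
      C.words.card * n * (n - 1) * l := by
    linear_combination C.words.card * h2
  exact_mod_cast h3

theorem IsThreeWeight.card_minimum_eq (h : C.IsThreeWeight d N) :
    2 * (n * n) + 2 * (C.wordsOf d).card * ((n - 2 * d) * (n - 2 * d)) = n * C.words.card := by
  have h1 := h.card_minimum_mul
  have h2 : 2 * d ≤ n := by have := h.length; have := h.lt; omega
  zify [h2]
  linear_combination h1

theorem nonempty_and_delta_lt_sMax {W : List ℕ} (hW : (n, d, W) ∈ parameterTable)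
    (hC : C.IsAssmusMattson d 4 1) (h : C.IsThreeWeight d N)
    (h16 : ¬ (n = 16 ∧ Module.finrank (ZMod 2) C = 8))
    (h48 : ¬ (n = 48 ∧ Module.finrank (ZMod 2) C = 13)) :
    (∀ w ∈ W, (C.dual.supportBlocks w).Nonempty) ∧ C.dual.delta < C.dual.sMax := by
  obtain ⟨hn8, -, -, hdn, -⟩ := criteria_of_mem_parameterTable hW
  have hpar := List.all_eq_true.1 weightTest_all _ hW
  simp only [Bool.and_eq_true, List.all_eq_true, beq_iff_eq, Nat.blt_eq] at hpar
  have htest := List.all_eq_true.1 dimensionTest_all _ hW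
  simp only [dimensionTest, Bool.and_eq_true, List.all_eq_true, decide_eq_true_eq, List.mem_range,
    Bool.or_eq_true, beq_iff_eq] at htest
  obtain ⟨hpos, hlt, hall⟩ := htest
  set k := Module.finrank (ZMod 2) C with hk
  have hq : C.words.card = 2 ^ k := card_words C
  have hk80 : k < 80 := by
    have h1 := (Int.le_of_dvd (by linarith) h.card_words_dvd).trans_lt hlt
    rw [hq] at h1
    exact (Nat.pow_lt_pow_iff_right (by norm_num : 1 < 2)).1 (by exact_mod_cast h1)
  have hcard := h.card_minimum_eq
  -- The second moment recovers the number of words of minimum weight from the dimension.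
  have ha : (n * 2 ^ k - 2 * (n * n)) / (2 * ((n - 2 * d) * (n - 2 * d))) =
      (C.wordsOf d).card := by
    have hg : 0 < (n - 2 * d) * (n - 2 * d) := Nat.mul_pos (by omega) (by omega)
    rw [← hq, ← hcard, Nat.add_sub_cancel_left, mul_assoc, mul_left_comm,
      Nat.mul_div_cancel _ (by positivity)]
  have ht := ((hall k hk80).resolve_left h16).resolve_left h48
  rw [ha, ← hq] at ht
  obtain ⟨hne1, hne2⟩ := hC.wordsOf_nonempty h.length h.lt
  have ha1 : 0 < (C.wordsOf d).card := hne1.card_pos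
  have hb1 : 0 < (C.wordsOf N).card := hne2.card_pos
  have hsum := h.card_words_eq
  obtain ⟨y, hy, -, hy4⟩ := hC.dual_minDist.1
  have hB4 : (C.dual.supportBlocks 4).Nonempty := by
    rw [supportBlocks_eq_image, Finset.image_nonempty]
    exact ⟨y, mem_wordsOf.2 ⟨hy, hy4⟩⟩
  have hB4' := hB4.card_pos
  have hq0 : 0 < C.words.card := by rw [hq]; positivity
  simp only [cardTest, Bool.or_eq_true, bne_iff_ne, Nat.blt_eq, decide_eq_true_eq,
    Bool.and_eq_true, List.all_eq_true] at ht
  have hB : ∀ m, (0 : ℤ) ≤ scaledDualCount n d C.words.card (C.wordsOf d).card m := fun m => by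
    rw [← h.card_mul_eq_scaledDualCount]; positivity
  have h2 := h.card_mul_eq_scaledDualCount 2
  -- All alternatives but the last contradict the existence of `C`; the last yields words of all
  -- listed weights and a design for weight 4 that is not a `2`-design.
  rcases ht with ht | ht | ht | ht | ht | ht | ⟨ht4, ht⟩
  · exact absurd hcard ht
  · omega
  · omega
  · exact absurd (Int.emod_eq_zero_of_dvd ⟨_, h2.symm⟩) ht
  · rw [← h2] at ht
    have : (0 : ℤ) < C.words.card * (C.dual.supportBlocks (2 * 2)).card := by
      exact_mod_cast Nat.mul_pos hq0 hB4'
    exact absurd ht (not_le.2 this)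
  · exact absurd ht (not_lt.2 (hB 3))
  · have hne : ∀ w ∈ W, (C.dual.supportBlocks w).Nonempty := fun w hw =>
      h.supportBlocks_nonempty (hpar.2 w hw).2.2.1 (ht w hw)
    refine ⟨hne, ?_⟩
    have hWne : ∃ w, w ∈ W := by
      have := List.all_eq_true.1 (show (parameterTable.all fun e => !e.2.2.isEmpty) = true by
        decide +kernel) _ hW
      exact List.exists_mem_of_ne_nil W (by simpa using this)
    obtain ⟨w, hw⟩ := hWne
    obtain ⟨hw1, hw2, -⟩ := hpar.2 w hw
    exact delta_lt_sMax ⟨by omega, hw2, hne w hw⟩ (isDesign_of_mem_parameterTable hW h hw)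
      ⟨by norm_num, by omega, hB4⟩ (h.not_isDesign_four ht4)

end

end BinaryCode

theorem corollary1p3 :
    (∀ n d w : ℕ,
      (∃ W : List ℕ, (n, d, W) ∈ BinaryCode.parameterTable ∧ w ∈ W) ↔
        (8 < n ∧ n ≤ 10000 ∧ 0 < d ∧ 2 * d < n ∧
          BinaryCode.IntegralityCriterion n d ∧ BinaryCode.DesignCriterion n d w)) ∧
    (∀ (n d : ℕ) (W : List ℕ), (n, d, W) ∈ BinaryCode.parameterTable →
      ∀ C : BinaryCode n, C.IsAssmusMattson d 4 1 →
        (∀ w ∈ W, BinaryCode.IsDesign 2 w (C.dual.supportBlocks w)) ∧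
        (¬ (n = 16 ∧ Module.finrank (ZMod 2) C = 8) →
          ¬ (n = 48 ∧ Module.finrank (ZMod 2) C = 13) →
            (∀ w ∈ W, (C.dual.supportBlocks w).Nonempty) ∧
            C.dual.delta < C.dual.sMax)) := by
  refine ⟨BinaryCode.mem_parameterTable_iff, fun n d W hW C hC => ?_⟩
  obtain ⟨-, -, -, hdn, -⟩ := BinaryCode.criteria_of_mem_parameterTable hW
  obtain ⟨N, hN, -⟩ := hC.exists_half hdn
  have h := hC.isThreeWeight hN (by omega)
  exact ⟨fun w hw => BinaryCode.isDesign_of_mem_parameterTable hW h hw,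
    fun h16 h48 => BinaryCode.nonempty_and_delta_lt_sMax hW hC h h16 h48⟩
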